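/- **Setting.** A *host graph* is a finite directed graph (parallel edges and loops allowed) whose nodes and edges carry labels (finite lists of integers and character strings); each node is unmarked or marked red, green, blue or grey and is either a root or not; each edge is unmarked or marked red, green, blue or dashed. Its *size* is its number of nodes plus its number of edges, and the degree of a node is its indegree plus its outdegree. An *input graph* is a connected, arbitrarily labelled host graph (possibly empty) in which every node is grey and unrooted and every edge is unmarked. A rule $L\Rightarrow R$ is applied by choosing values for its list variables, marks for its magenta nodes and a direction for its undirected edges, matching $L$ injectively in the host graph (preserving labels and marks, preserving and reflecting rootedness), and replacing it by $R$; numbered nodes stay in place. Commands: a call $\{r_1,\dots,r_n\}$ non-deterministically applies one applicable rule and fails if there is none; `if C then P else Q` runs $C$ on a copy of the graph and then runs $P$, respectively $Q$, on the original graph according as $C$ succeeds or fails; `try` is the same except that $P$ runs on the result of $C$; $P!$ repeats $P$ until it fails (and then returns the graph on which $P$ was last entered) or until `break`; missing branches do nothing. **The program** `top-sort`. Notation: a node is written "number: label mark", with $^{*}$ for a root; $\varepsilon$ is the empty list, and $a,b,x,y,z$ are list variables; $\to$ is a directed and $-$ an undirected edge, followed by mark and label (no label: empty list; "plain": unmarked).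 - `Main` = `try init then (StackNodes!; unroot; LoopNodes!; if flag then fail)` - `StackNodes` = `{forward1, forward2}!; try back else break` - `LoopNodes` = `if flag then break; try skip1 else (try skip2 else (try init1 then (SortNodes!) else (try init2 then (SortNodes!) else break)))` - `SortNodes` = `forward!; if {loop, two_cycle, back_edge} then (set_flag; break); try back_push else (try back_first_push else (try grey_push else grey_first_push; break))`, where the last `break` follows the command `try grey_push else grey_first_push`. Rules: - `flag`: $1{:}\,x$ unmarked$^*$ $\Rightarrow$ the same. - `init`: $1{:}\,x$ grey $\Rightarrow$ $1{:}\,x$ red$^*$, a new node $2{:}\,\varepsilon$ green$^*$, $2\to1$ red. - `forward1`: $1{:}\,x$ red$^*$, $2{:}\,y$ grey, $3{:}\,\varepsilon$ green$^*$, $1-2$ plain $a$, $3\to1$ red $\Rightarrow$ $1{:}\,x$ red, $2{:}\,y$ red$^*$, $3{:}\,\varepsilon$ green$^*$, $1-2$ dashed $a$, $3\to2$ red, $2\to1$ red. - `forward2`: $1{:}\,x$ red$^*$, $2{:}\,y$ grey, $3{:}\,z$ red, $4{:}\,\varepsilon$ green$^*$, $1-2$ plain $a$, $4\to3$ red $\Rightarrow$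 $1{:}\,x$ red, $2{:}\,y$ red$^*$, $3{:}\,z$ red, $4{:}\,\varepsilon$ green$^*$, $1-2$ dashed $a$, $2\to3$ red, $4\to2$ red. - `back`: $1{:}\,x$ red, $2{:}\,y$ red$^*$, $1-2$ dashed $a$ $\Rightarrow$ $1{:}\,x$ red$^*$, $2{:}\,y$ red, $1-2$ plain $a$. - `unroot`: $1{:}\,x$ red$^*$ $\Rightarrow$ $1{:}\,x$ red. - `skip1`: $1{:}\,x$ blue, $2{:}\,y$ magenta, $3{:}\,z$ green$^*$, $1\to2$ red, $3\to1$ red $\Rightarrow$ the same nodes, $3\to2$ red. `init1` is the same with node 1 red on the left and grey$^*$ on the right. - `skip2`: $1{:}\,x$ blue, $2{:}\,y$ green$^*$, $2\to1$ red $\Rightarrow$ the same nodes, no edge. `init2` is the same with node 1 red on the left and grey$^*$ on the right. - `forward`: $1{:}\,x$ grey$^*$, $2{:}\,y$ red, $1\to2$ plain $a$ $\Rightarrow$ $1{:}\,x$ grey, $2{:}\,y$ grey$^*$, $1\to2$ dashed $a$. - `loop`: $1{:}\,x$ grey$^*$, $1\to1$ plain $a$ $\Rightarrow$ the same. - `set_flag`: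 $1{:}\,x$ grey$^*$ $\Rightarrow$ $1{:}\,x$ unmarked$^*$. - `two_cycle`: $1{:}\,x$ grey, $2{:}\,y$ grey$^*$, $1\to2$ dashed $a$, $2\to1$ plain $b$ $\Rightarrow$ the same. - `back_edge`: $1{:}\,x$ grey, $2{:}\,y$ grey$^*$, $3{:}\,z$ grey, $2\to3$ plain $a$, $3\to1$ dashed $b$ $\Rightarrow$ the same. - `grey_first_push`: $1{:}\,\varepsilon$ green$^*$, $2{:}\,x$ grey$^*$ $\Rightarrow$ $1{:}\,0$ green$^*$, $2{:}\,x$ blue, $1\to2$ blue. - `grey_push`: $1{:}\,x$ grey$^*$, $2{:}\,y$ blue, $3{:}\,0$ green$^*$, $3\to2$ blue $\Rightarrow$ $1{:}\,x$ blue, $2{:}\,y$ blue, $3{:}\,0$ green$^*$, $3\to1$ blue, $1\to2$ blue. - `back_first_push`: $1{:}\,x$ grey, $2{:}\,y$ grey$^*$, $3{:}\,\varepsilon$ green$^*$, $1\to2$ dashed $a$ $\Rightarrow$ $1{:}\,x$ grey$^*$, $2{:}\,y$ blue, $3{:}\,0$ green$^*$, $1\to2$ plain $a$, $3\to2$ blue.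 - `back_push`: $1{:}\,x$ grey, $2{:}\,y$ grey$^*$, $3{:}\,0$ green$^*$, $4{:}\,z$ blue, $1\to2$ dashed $a$, $3\to4$ blue $\Rightarrow$ $1{:}\,x$ grey$^*$, $2{:}\,y$ blue, $3{:}\,0$ green$^*$, $4{:}\,z$ blue, $1\to2$ plain $a$, $3\to2$ blue, $2\to4$ blue. **Time.** A rule is matched by backtracking: the roots of $L$ are sought among the roots of the host graph, then edges with an endpoint already placed are sought among the edges at its image, and only nodes of $L$ not reachable from a root are sought among all nodes. Each inspection of a host item costs one unit; a rule call, successful or not, is charged for the complete search, and an application also for each item of $L$ and $R$. Every other command step (in particular `break` and `fail`) costs one unit. Loading the input and printing the result cost one unit per node and edge. **Theorem (Complexity of `top-sort`).** For every $D$ there is a constant $c$ such that for every input graph $G$ all of whose nodes have degree at most $D$: no execution of `top-sort` on $G$ diverges or gets stuck, and every execution, including the executions of conditions and loop bodies, takes time at most $c\,(\mathrm{size}(G)+1)$. -/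

import Mathlib

namespace GP2

/-! # Host graphs -/

/-- Labels of host graphs: lists of integers and character strings. -/
abbrev Label := List (ℤ ⊕ String)

/-- Node marks; `none` means unmarked. -/
inductive NodeMark
  | none | red | green | blue | grey
  deriving DecidableEq

/-- Edge marks; `none` means unmarked. -/
inductive EdgeMark
  | none | red | green | blue | dashed
  deriving DecidableEq

/-- What a node of a host graph carries. -/
structure NodeAttr where
  label : Label
  mark : NodeMark
  root : Bool
  deriving DecidableEq

/-- A directed, labelled and marked edge. -/
structure Edge where
  src : ℕ
  tgt : ℕ
  label : Label
  mark : EdgeMark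
  deriving DecidableEq

/-- A host graph: finitely many nodes, named by natural numbers, and a finite multiset of edges
between them, so that parallel edges and loops are allowed. (The value of `attr` at a number
that does not name a node is irrelevant.) -/
structure HostGraph where
  nodes : Finset ℕ
  attr : ℕ → NodeAttr
  edges : Multiset Edge
  incident : ∀ e ∈ edges, e.src ∈ nodes ∧ e.tgt ∈ nodes

namespace HostGraph

/-- The size of a host graph: the total number of its nodes and edges. -/
def size (G : HostGraph) : ℕ := G.nodes.card + Multiset.card G.edges

/-- The root nodes. -/
def roots (G : HostGraph) : Finset ℕ := G.nodes.filter fun v => (G.attr v).root = true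

/-- The outgoing edges of a node. -/
def outEdges (G : HostGraph) (v : ℕ) : Multiset Edge := G.edges.filter fun e => e.src = v

/-- The incoming edges of a node. -/
def inEdges (G : HostGraph) (v : ℕ) : Multiset Edge := G.edges.filter fun e => e.tgt = v

/-- The degree of a node: its outdegree plus its indegree (a loop counts twice). -/
def degree (G : HostGraph) (v : ℕ) : ℕ :=
  Multiset.card (G.outEdges v) + Multiset.card (G.inEdges v)

/-- There is an edge from `v` to `w` or from `w` to `v`. -/
def Adjacent (G : HostGraph) (v w : ℕ) : Prop :=
  ∃ e ∈ G.edges, (e.src = v ∧ e.tgt = w) ∨ (e.src = w ∧ e.tgt = v)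

/-- Any two nodes are joined by an undirected path. (The empty graph is included.) -/
def Connected (G : HostGraph) : Prop :=
  ∀ v ∈ G.nodes, ∀ w ∈ G.nodes, Relation.ReflTransGen G.Adjacent v w

/-- Input graphs: connected, arbitrarily labelled host graphs all of whose nodes are grey and
unrooted and all of whose edges are unmarked. -/
structure IsInput (G : HostGraph) : Prop where
  connected : G.Connected
  grey : ∀ v ∈ G.nodes, (G.attr v).mark = NodeMark.grey
  unrooted : ∀ v ∈ G.nodes, (G.attr v).root = false
  unmarked : ∀ e ∈ G.edges, e.mark = EdgeMark.none

end HostGraph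

/-! # Rules

Only what the program below uses is modelled: unconditional rules that delete no nodes (so that
the dangling condition is void), whose labels are list variables or constant lists. -/

/-- A label in a rule: a variable of type `list`, or a constant. -/
inductive LabelPat
  | var (n : ℕ)
  | const (l : Label)

/-- A node mark in a rule: a fixed mark, or the wildcard (drawn in magenta); the argument of
`wild` identifies the occurrences on the two sides of a rule. -/
inductive MarkPat
  | fixed (m : NodeMark)
  | wild (n : ℕ)

/-- A node of a rule graph. -/
structure NodePat where
  label : LabelPat
  mark : MarkPat
  root : Bool

/-- An edge of a rule graph with `n` nodes. `bidir = Option.none` for a directed edge;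
`bidir = some i` for an edge drawn without an arrowhead, which stands for an edge in either
direction, the same for all edges of the rule with the same `i`. -/
structure EdgePat (n : ℕ) where
  src : Fin n
  tgt : Fin n
  label : LabelPat
  mark : EdgeMark
  bidir : Option ℕ

/-- A rule graph with `n` nodes. -/
structure Pattern (n : ℕ) where
  node : Fin n → NodePat
  edges : List (EdgePat n)

/-- A rule `L ⇒ R`. The `k` nodes of `L` are preserved and are the first `k` nodes of `R`; the
other `j` nodes of `R` are created. -/
structure Rule where
  k : ℕ
  j : ℕ
  L : Pattern k
  R : Pattern (k + j)

/-- The data that instantiates a rule: values of the list variables, marks for the wildcards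
(any mark, but not the absence of one), and a direction for each bidirectional edge. -/
structure Inst where
  val : ℕ → Label
  wild : ℕ → NodeMark
  reversed : ℕ → Bool
  wild_marked : ∀ n, wild n ≠ NodeMark.none

def LabelPat.inst (ι : Inst) : LabelPat → Label
  | .var n => ι.val n
  | .const l => l

def MarkPat.inst (ι : Inst) : MarkPat → NodeMark
  | .fixed m => m
  | .wild n => ι.wild n

def NodePat.inst (ι : Inst) (p : NodePat) : NodeAttr :=
  ⟨p.label.inst ι, p.mark.inst ι, p.root⟩

/-- The host edge that `e` becomes when the nodes of the rule graph are placed by `g`. -/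
def EdgePat.inst {n : ℕ} (ι : Inst) (g : Fin n → ℕ) (e : EdgePat n) : Edge :=
  if (e.bidir.map ι.reversed).getD false then
    ⟨g e.tgt, g e.src, e.label.inst ι, e.mark⟩
  else
    ⟨g e.src, g e.tgt, e.label.inst ι, e.mark⟩

def Pattern.instEdges {n : ℕ} (P : Pattern n) (ι : Inst) (g : Fin n → ℕ) : Multiset Edge :=
  (P.edges.map (EdgePat.inst ι g) : List Edge)

/-- `g` embeds the instantiated rule graph injectively in the host graph. Rootedness is both
preserved and reflected; parallel edges of the rule graph need distinct edges of `G`. -/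
structure Pattern.IsMatch {n : ℕ} (P : Pattern n) (G : HostGraph) (ι : Inst) (g : Fin n → ℕ) :
    Prop where
  injective : Function.Injective g
  mem : ∀ i, g i ∈ G.nodes
  attr : ∀ i, G.attr (g i) = (P.node i).inst ι
  edges : P.instEdges ι g ≤ G.edges

/-- `H` results from `G` by applying `r` with the instantiation `ι`; `g` gives the match on the
nodes of the left-hand side and the names of the created nodes. -/
structure Rule.AppliesVia (r : Rule) (G H : HostGraph) (ι : Inst) (g : Fin (r.k + r.j) → ℕ) :
    Prop where
  injective : Function.Injective g
  isMatch : r.L.IsMatch G ι fun i => g (Fin.castAdd r.j i)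
  fresh : ∀ i : Fin r.j, g (Fin.natAdd r.k i) ∉ G.nodes
  nodes : H.nodes = G.nodes ∪ Finset.univ.image g
  attr : ∀ i, H.attr (g i) = (r.R.node i).inst ι
  attr_of_notMem : ∀ v ∉ Set.range g, H.attr v = G.attr v
  edges : H.edges =
    G.edges - r.L.instEdges ι (fun i => g (Fin.castAdd r.j i)) + r.R.instEdges ι g

/-- `G ⇒_r H`. -/
def Rule.Applies (r : Rule) (G H : HostGraph) : Prop := ∃ ι g, r.AppliesVia G H ι g

/-! # The time needed to match and to apply a rule

A match is sought by backtracking along a search plan that depends only on the left-hand side: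
first its roots are sought among the roots of the host graph; then edges with an endpoint already
placed are sought among the edges at the image of that endpoint; only when there is no such edge,
a node is sought among all nodes of the host graph. Fetching an item of the host graph and
testing it takes one unit of time. -/

/-- One instruction of a search plan. -/
inductive SearchOp (n : ℕ)
  /-- place the root `i`, going through the roots of the host graph -/
  | root (i : Fin n)
  /-- place the node `i`, going through all nodes of the host graph -/
  | node (i : Fin n)
  /-- place `e` and its target, going through the edges at the image of its source -/
  | fromSrc (e : EdgePat n)
  /-- place `e` and its source, going through the edges at the image of its target -/
  | fromTgt (e : EdgePat n)

/-- The part of a search plan that comes after the nodes in `placed` have been placed, where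
`todo` are the edges that are yet to be placed. -/
def growPlan {n : ℕ} : (fuel : ℕ) → (placed : List (Fin n)) → (todo : List (EdgePat n)) →
    List (SearchOp n)
  | 0, _, _ => []
  | fuel + 1, placed, todo =>
    match todo.find? fun e => decide (e.src ∈ placed ∨ e.tgt ∈ placed) with
    | some e =>
      let todo' := todo.eraseP fun e => decide (e.src ∈ placed ∨ e.tgt ∈ placed)
      if e.src ∈ placed then
        .fromSrc e :: growPlan fuel (e.tgt :: placed) todo'
      else
        .fromTgt e :: growPlan fuel (e.src :: placed) todo'
    | Option.none =>
      match (List.finRange n).find? fun i => decide (i ∉ placed) with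
      | some i => .node i :: growPlan fuel (i :: placed) todo
      | Option.none => []

/-- The search plan for a left-hand side. -/
def Pattern.plan {n : ℕ} (P : Pattern n) : List (SearchOp n) :=
  let rs := (List.finRange n).filter fun i => (P.node i).root
  rs.map SearchOp.root ++ growPlan (n + P.edges.length) rs P.edges

/-- The label and the mark can be those of an instance. -/
def LabelPat.admits : LabelPat → Label → Bool
  | .var _, _ => true
  | .const l, l' => decide (l = l')

def MarkPat.admits : MarkPat → NodeMark → Bool
  | .fixed m, m' => decide (m = m')
  | .wild _, m' => decide (m' ≠ NodeMark.none)

def NodePat.admits (p : NodePat) (a : NodeAttr) : Bool :=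
  p.label.admits a.label && p.mark.admits a.mark && decide (p.root = a.root)

/-- A partial match: where the nodes placed so far lie, and the host edges in use. -/
structure SearchState (n : ℕ) where
  place : Fin n → Option ℕ
  used : Multiset Edge

/-- The host node `v` may be taken for the node `i`: either `i` has been placed at `v`, or `i`
has not been placed, `v` is not in use, and `v` has the required label, mark and rootedness. -/
def SearchState.fits {n : ℕ} (P : Pattern n) (G : HostGraph) (s : SearchState n) (i : Fin n)
    (v : ℕ) : Bool :=
  match s.place i with
  | some w => decide (w = v)
  | Option.none => decide (∀ i', s.place i' ≠ some v) && (P.node i).admits (G.attr v)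

def SearchState.setNode {n : ℕ} (s : SearchState n) (i : Fin n) (v : ℕ) : SearchState n :=
  ⟨Function.update s.place i (some v), s.used⟩

/-- Given the multisets of the outgoing and of the incoming edges of a placed endpoint of `e`,
the host edges to go through for `e`, each with its endpoint that is to be taken for the other
endpoint of `e`. -/
def EdgePat.candidates {n : ℕ} (e : EdgePat n) (atSrc : Bool) (outs ins : Multiset Edge) :
    Multiset (Edge × ℕ) :=
  let viaOut := outs.map fun h => (h, h.tgt)
  let viaIn := ins.map fun h => (h, h.src)
  if e.bidir.isSome then viaOut + viaIn else if atSrc then viaOut else viaIn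

/-- The time for a complete backtracking search along a plan from a given partial match:
for every instruction, all items offered for it are inspected, and the search is continued from
every item that passes the tests. This is the worst case for a search that ends with the first
match, whatever the order in which items are offered. -/
def searchTime {n : ℕ} (P : Pattern n) (G : HostGraph) : List (SearchOp n) → SearchState n → ℕ
  | [], _ => 1
  | .root i :: ops, s =>
    1 + G.roots.card +
      ∑ v ∈ G.roots.filter (fun v => s.fits P G i v), searchTime P G ops (s.setNode i v)
  | .node i :: ops, s =>
    1 + G.nodes.card +
      ∑ v ∈ G.nodes.filter (fun v => s.fits P G i v), searchTime P G ops (s.setNode i v)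
  | .fromSrc e :: ops, s =>
    match s.place e.src with
    | Option.none => 1
    | some v =>
      1 + Multiset.card (e.candidates true (G.outEdges v) (G.inEdges v)) +
        (((e.candidates true ((G.edges - s.used).filter fun h => h.src = v)
            ((G.edges - s.used).filter fun h => h.tgt = v)).filter fun c =>
              c.1.mark = e.mark ∧ e.label.admits c.1.label ∧ s.fits P G e.tgt c.2).map fun c =>
          searchTime P G ops
            ⟨Function.update s.place e.tgt (some c.2), c.1 ::ₘ s.used⟩).sum
  | .fromTgt e :: ops, s =>
    match s.place e.tgt with
    | Option.none => 1
    | some v =>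
      1 + Multiset.card (e.candidates false (G.outEdges v) (G.inEdges v)) +
        (((e.candidates false ((G.edges - s.used).filter fun h => h.src = v)
            ((G.edges - s.used).filter fun h => h.tgt = v)).filter fun c =>
              c.1.mark = e.mark ∧ e.label.admits c.1.label ∧ s.fits P G e.src c.2).map fun c =>
          searchTime P G ops
            ⟨Function.update s.place e.src (some c.2), c.1 ::ₘ s.used⟩).sum

/-- The time to search for a match of `r` in `G`. -/
def Rule.matchTime (r : Rule) (G : HostGraph) : ℕ :=
  searchTime r.L G r.L.plan ⟨fun _ => Option.none, 0⟩

/-- The time to replace a match of `L` by `R`: one unit for each item of `L` and of `R`. -/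
def Rule.replaceTime (r : Rule) : ℕ :=
  r.k + r.L.edges.length + (r.k + r.j) + r.R.edges.length

/-- The time to search for matches of all rules of a rule set. -/
def callTime (rs : List Rule) (G : HostGraph) : ℕ := 1 + (rs.map fun r => r.matchTime G).sum

/-! # Commands and their semantics -/

/-- Command sequences. `call` calls a rule set, `loop P` is `P!`. -/
inductive Com
  | call (rs : List Rule)
  | seq (P Q : Com)
  | ifte (C P Q : Com)
  | tryte (C P Q : Com)
  | loop (P : Com)
  | brk
  | skip
  | fail

/-- Configurations: a command sequence with a host graph, a host graph, or failure. -/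
inductive Config
  | run (P : Com) (G : HostGraph)
  | done (G : HostGraph)
  | failed

mutual

/-- `Step P G c t`: the transition `⟨P, G⟩ → c` of the operational semantics, where `t` is the
time it takes, including the time for the transitions in its premise. (Going back to `G` after a
condition or after the last execution of a loop body is not charged separately: undoing recorded
changes takes no longer than making them, which has been charged.) -/
inductive Step : Com → HostGraph → Config → ℕ → Prop
  | call₁ {rs : List Rule} {r : Rule} {G H : HostGraph} : r ∈ rs → r.Applies G H →
      Step (.call rs) G (.done H) (callTime rs G + r.replaceTime)
  | call₂ {rs : List Rule} {G : HostGraph} : (∀ r ∈ rs, ∀ H, ¬ r.Applies G H) →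
      Step (.call rs) G .failed (callTime rs G)
  | seq₁ {P P' Q : Com} {G H : HostGraph} {t : ℕ} : Step P G (.run P' H) t →
      Step (.seq P Q) G (.run (.seq P' Q) H) t
  | seq₂ {P Q : Com} {G H : HostGraph} {t : ℕ} : Step P G (.done H) t →
      Step (.seq P Q) G (.run Q H) t
  | seq₃ {P Q : Com} {G : HostGraph} {t : ℕ} : Step P G .failed t →
      Step (.seq P Q) G .failed t
  | if₁ {C P Q : Com} {G H : HostGraph} {t : ℕ} : Steps (.run C G) (.done H) t →
      Step (.ifte C P Q) G (.run P G) (t + 1)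
  | if₂ {C P Q : Com} {G : HostGraph} {t : ℕ} : Steps (.run C G) .failed t →
      Step (.ifte C P Q) G (.run Q G) (t + 1)
  | try₁ {C P Q : Com} {G H : HostGraph} {t : ℕ} : Steps (.run C G) (.done H) t →
      Step (.tryte C P Q) G (.run P H) (t + 1)
  | try₂ {C P Q : Com} {G : HostGraph} {t : ℕ} : Steps (.run C G) .failed t →
      Step (.tryte C P Q) G (.run Q G) (t + 1)
  | alap₁ {P : Com} {G H : HostGraph} {t : ℕ} : Steps (.run P G) (.done H) t →
      Step (.loop P) G (.run (.loop P) H) (t + 1)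
  | alap₂ {P : Com} {G : HostGraph} {t : ℕ} : Steps (.run P G) .failed t →
      Step (.loop P) G (.done G) (t + 1)
  | alap₃ {P : Com} {G H : HostGraph} {t : ℕ} : Steps (.run P G) (.run .brk H) t →
      Step (.loop P) G (.done H) (t + 1)
  | brk {P : Com} {G : HostGraph} : Step (.seq .brk P) G (.run .brk G) 1
  | skip {G : HostGraph} : Step .skip G (.done G) 1
  | fail {G : HostGraph} : Step .fail G .failed 1

/-- `Steps c c' t`: `c →* c'`, in total time `t`. -/
inductive Steps : Config → Config → ℕ → Prop
  | refl {c : Config} : Steps c c 0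
  | head {P : Com} {G : HostGraph} {c c' : Config} {t t' : ℕ} : Step P G c t → Steps c c' t' →
      Steps (.run P G) c' (t + t')

end

/-- `P` can diverge from `G`: there is an infinite sequence of transitions. -/
def CanDiverge (P : Com) (G : HostGraph) : Prop :=
  ∃ f : ℕ → Com × HostGraph, f 0 = (P, G) ∧
    ∀ i, ∃ t, Step (f i).1 (f i).2 (.run (f (i + 1)).1 (f (i + 1)).2) t

/-- `P` can get stuck from `G`: a terminal configuration with a rest program can be reached. -/
def CanGetStuck (P : Com) (G : HostGraph) : Prop :=
  ∃ Q H t, Steps (.run P G) (.run Q H) t ∧ ∀ c t', ¬ Step Q H c t'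

/-- `Spends P G t`: some execution of `P` on `G`, finished or not, has taken time `t` at some
point. Here the unfinished executions of the condition of a branching command and of a loop body
are followed as well, which are invisible to the transition relation. -/
inductive Spends : Com → HostGraph → ℕ → Prop
  | zero {P : Com} {G : HostGraph} : Spends P G 0
  | last {P : Com} {G : HostGraph} {c : Config} {t : ℕ} : Step P G c t → Spends P G t
  | step {P P' : Com} {G G' : HostGraph} {t t' : ℕ} : Step P G (.run P' G') t →
      Spends P' G' t' → Spends P G (t + t')
  | seq {P Q : Com} {G : HostGraph} {t : ℕ} : Spends P G t → Spends (.seq P Q) G t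
  | ifCond {C P Q : Com} {G : HostGraph} {t : ℕ} : Spends C G t → Spends (.ifte C P Q) G t
  | tryCond {C P Q : Com} {G : HostGraph} {t : ℕ} : Spends C G t → Spends (.tryte C P Q) G t
  | body {P : Com} {G : HostGraph} {t : ℕ} : Spends P G t → Spends (.loop P) G t

/-- `TimeSpent P G t`: time `t` has passed at some point of a run of the program `P` on the input
`G`. The run starts with loading `G` and ends, if there is a result, with printing the result;
either takes one unit of time per node and edge. -/
inductive TimeSpent (P : Com) (G : HostGraph) : ℕ → Prop
  | running {t : ℕ} : Spends P G t → TimeSpent P G (G.size + t)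
  | printed {H : HostGraph} {t : ℕ} : Steps (.run P G) (.done H) t →
      TimeSpent P G (G.size + t + H.size)

/-! # The program `top-sort` -/

namespace TopSort

def x : LabelPat := .var 0
def y : LabelPat := .var 1
def z : LabelPat := .var 2
def a : LabelPat := .var 3
def b : LabelPat := .var 4
/-- The empty list. -/
def nil : LabelPat := .const []
/-- The list that consists of the integer 0. -/
def zero : LabelPat := .const [Sum.inl 0]

/-- An unrooted node. -/
def nd (l : LabelPat) (m : NodeMark) : NodePat := ⟨l, .fixed m, false⟩
/-- A root. -/
def rt (l : LabelPat) (m : NodeMark) : NodePat := ⟨l, .fixed m, true⟩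
/-- An unrooted magenta node. -/
def anyNd (l : LabelPat) : NodePat := ⟨l, .wild 0, false⟩
/-- A directed edge. -/
def arrow {n : ℕ} (s t : Fin n) (l : LabelPat) (m : EdgeMark) : EdgePat n :=
  ⟨s, t, l, m, Option.none⟩
/-- A bidirectional edge. -/
def link {n : ℕ} (s t : Fin n) (l : LabelPat) (m : EdgeMark) : EdgePat n := ⟨s, t, l, m, some 0⟩

def flag : Rule where
  k := 1
  j := 0
  L := ⟨![rt x .none], []⟩
  R := ⟨![rt x .none], []⟩

def init : Rule where
  k := 1
  j := 1
  L := ⟨![nd x .grey], []⟩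
  R := ⟨![rt x .red, rt nil .green], [arrow 1 0 nil .red]⟩

def forward1 : Rule where
  k := 3
  j := 0
  L := ⟨![rt x .red, nd y .grey, rt nil .green], [link 0 1 a .none, arrow 2 0 nil .red]⟩
  R := ⟨![nd x .red, rt y .red, rt nil .green],
    [link 0 1 a .dashed, arrow 2 1 nil .red, arrow 1 0 nil .red]⟩

def forward2 : Rule where
  k := 4
  j := 0
  L := ⟨![rt x .red, nd y .grey, nd z .red, rt nil .green],
    [link 0 1 a .none, arrow 3 2 nil .red]⟩
  R := ⟨![nd x .red, rt y .red, nd z .red, rt nil .green],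
    [link 0 1 a .dashed, arrow 1 2 nil .red, arrow 3 1 nil .red]⟩

def back : Rule where
  k := 2
  j := 0
  L := ⟨![nd x .red, rt y .red], [link 0 1 a .dashed]⟩
  R := ⟨![rt x .red, nd y .red], [link 0 1 a .none]⟩

def unroot : Rule where
  k := 1
  j := 0
  L := ⟨![rt x .red], []⟩
  R := ⟨![nd x .red], []⟩

def skip1 : Rule where
  k := 3
  j := 0
  L := ⟨![nd x .blue, anyNd y, rt z .green], [arrow 0 1 nil .red, arrow 2 0 nil .red]⟩
  R := ⟨![nd x .blue, anyNd y, rt z .green], [arrow 2 1 nil .red]⟩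

def skip2 : Rule where
  k := 2
  j := 0
  L := ⟨![nd x .blue, rt y .green], [arrow 1 0 nil .red]⟩
  R := ⟨![nd x .blue, rt y .green], []⟩

def init1 : Rule where
  k := 3
  j := 0
  L := ⟨![nd x .red, anyNd y, rt z .green], [arrow 0 1 nil .red, arrow 2 0 nil .red]⟩
  R := ⟨![rt x .grey, anyNd y, rt z .green], [arrow 2 1 nil .red]⟩

def init2 : Rule where
  k := 2
  j := 0
  L := ⟨![nd x .red, rt y .green], [arrow 1 0 nil .red]⟩
  R := ⟨![rt x .grey, rt y .green], []⟩

def forward : Rule where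
  k := 2
  j := 0
  L := ⟨![rt x .grey, nd y .red], [arrow 0 1 a .none]⟩
  R := ⟨![nd x .grey, rt y .grey], [arrow 0 1 a .dashed]⟩

def loop : Rule where
  k := 1
  j := 0
  L := ⟨![rt x .grey], [arrow 0 0 a .none]⟩
  R := ⟨![rt x .grey], [arrow 0 0 a .none]⟩

def set_flag : Rule where
  k := 1
  j := 0
  L := ⟨![rt x .grey], []⟩
  R := ⟨![rt x .none], []⟩

def two_cycle : Rule where
  k := 2
  j := 0
  L := ⟨![nd x .grey, rt y .grey], [arrow 0 1 a .dashed, arrow 1 0 b .none]⟩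
  R := ⟨![nd x .grey, rt y .grey], [arrow 0 1 a .dashed, arrow 1 0 b .none]⟩

def back_edge : Rule where
  k := 3
  j := 0
  L := ⟨![nd x .grey, rt y .grey, nd z .grey], [arrow 1 2 a .none, arrow 2 0 b .dashed]⟩
  R := ⟨![nd x .grey, rt y .grey, nd z .grey], [arrow 1 2 a .none, arrow 2 0 b .dashed]⟩

def grey_first_push : Rule where
  k := 2
  j := 0
  L := ⟨![rt nil .green, rt x .grey], []⟩
  R := ⟨![rt zero .green, nd x .blue], [arrow 0 1 nil .blue]⟩

def grey_push : Rule where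
  k := 3
  j := 0
  L := ⟨![rt x .grey, nd y .blue, rt zero .green], [arrow 2 1 nil .blue]⟩
  R := ⟨![nd x .blue, nd y .blue, rt zero .green], [arrow 2 0 nil .blue, arrow 0 1 nil .blue]⟩

def back_first_push : Rule where
  k := 3
  j := 0
  L := ⟨![nd x .grey, rt y .grey, rt nil .green], [arrow 0 1 a .dashed]⟩
  R := ⟨![rt x .grey, nd y .blue, rt zero .green], [arrow 0 1 a .none, arrow 2 1 nil .blue]⟩

def back_push : Rule where
  k := 4
  j := 0
  L := ⟨![nd x .grey, rt y .grey, rt zero .green, nd z .blue],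
    [arrow 0 1 a .dashed, arrow 2 3 nil .blue]⟩
  R := ⟨![rt x .grey, nd y .blue, rt zero .green, nd z .blue],
    [arrow 0 1 a .none, arrow 2 1 nil .blue, arrow 1 3 nil .blue]⟩

/-- `{forward1, forward2}!; try back else break` -/
def StackNodes : Com :=
  .seq (.loop (.call [forward1, forward2]))
    (.tryte (.call [back]) .skip .brk)

/-- `forward!; if {loop, two_cycle, back_edge} then (set_flag; break);`
`try back_push else (try back_first_push else (try grey_push else (grey_first_push); break))` -/
def SortNodes : Com :=
  .seq (.loop (.call [forward]))
    (.seq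
      (.ifte (.call [loop, two_cycle, back_edge])
        (.seq (.call [set_flag]) .brk)
        .skip)
      (.tryte (.call [back_push]) .skip
        (.tryte (.call [back_first_push]) .skip
          (.seq
            (.tryte (.call [grey_push]) .skip (.call [grey_first_push]))
            .brk))))

/-- `if flag then break; try skip1 else (try skip2 else (try init1 then (SortNodes!) else`
`(try init2 then (SortNodes!) else (break))))` -/
def LoopNodes : Com :=
  .seq
    (.ifte (.call [flag]) .brk .skip)
    (.tryte (.call [skip1]) .skip
      (.tryte (.call [skip2]) .skip
        (.tryte (.call [init1]) (.loop SortNodes)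
          (.tryte (.call [init2]) (.loop SortNodes)
            .brk))))

/-- `try init then (StackNodes!; unroot; LoopNodes!; if flag then fail)` -/
def Main : Com :=
  .tryte (.call [init])
    (.seq (.loop StackNodes)
      (.seq (.call [unroot])
        (.seq (.loop LoopNodes)
          (.ifte (.call [flag]) .fail .skip))))
    .skip

end TopSort

end GP2

namespace GP2

/-! # Budgeted correctness of commands -/

-- Apart from `init`, which is called only once and searches all nodes, every rule has a search plan
-- that starts at roots and then only follows edges. As long as there are at most two roots and all
-- degrees are at most `D + 4`, a call therefore costs at most the constant `callBound (D + 4)`. It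
-- remains to keep roots and degrees bounded and to show that only linearly many calls are made.
--
-- Apart from the presence of a root with a given mark, the invariants are bounds on weights: sums
-- of contributions of nodes and edges, taken at one node or over the whole graph. Applying a rule
-- exchanges the contribution of `L` for that of `R` (`Rule.AppliesVia.loc_castAdd`,
-- `Rule.AppliesVia.tot`), so each invariant becomes a finite check on the rule graphs; these checks
-- are collected in `Keeps`. The degree bound holds because a node carries a reserve for the red and
-- blue edges it may still get. The number of calls is controlled by `potential`, which is at most
-- five times the input size, never increases, and drops with every application after which a loop
-- continues; the other calls in a round are boundedly many. The size plus the potential never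
-- increases either, so a result is at most six times as large as the input.
--
-- The roots need the control flow. While nodes are sorted there is one root besides the green one,
-- and it has to be unrooted, or unmarked by `set_flag`, before another one is created. Unmarked, it
-- makes `flag` applicable, which ends `LoopNodes!`. The delicate point is that `SortNodes` must not
-- fail and leave its grey root behind: `Inv.exists_push` derives from invariants of the blue edges
-- that one of the two final pushes is applicable.
--
-- These facts are combined by `Spec`, a Hoare logic in which a budget is passed along as in
-- amortized analysis: a constant credit per unit of potential, plus fixed reserves. As each
-- transition takes time, a budget also excludes divergence.

/-- Every transition takes time. -/
theorem Step.time_pos {P : Com} {G : HostGraph} {c : Config} {t : ℕ} (h : Step P G c t) :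
    1 ≤ t := by
  refine Step.rec (motive_1 := fun _ _ _ t _ => 1 ≤ t) (motive_2 := fun _ _ _ _ => True)
    ?_ ?_ ?_ ?_ ?_ ?_ ?_ ?_ ?_ ?_ ?_ ?_ ?_ ?_ ?_ ?_ ?_ h <;>
    (intros; simp_all [callTime]; try omega)

theorem not_step_brk {G : HostGraph} {c : Config} {t : ℕ} : ¬ Step .brk G c t := nofun

/-- The configurations in which the execution of a loop body may end. -/
def Config.Final : Config → Prop
  | .run P _ => P = .brk
  | .done _ => True
  | .failed => True

/-- `Spec P G B R`: executing `P` on `G` takes time at most `B`, does not get stuck, and ends, with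
a part `b` of the budget `B` left over, in a configuration `c` with `R c b`. -/
structure Spec (P : Com) (G : HostGraph) (B : ℕ) (R : Config → ℕ → Prop) : Prop where
  time : ∀ t, Spends P G t → t ≤ B
  post : ∀ c t, Steps (.run P G) c t → c.Final → ∃ b, t + b ≤ B ∧ R c b
  live : ∀ Q H t, Steps (.run P G) (.run Q H) t → Q = .brk ∨ ∃ c t', Step Q H c t'

/-- What `Spec` demands of a configuration reached with budget `b`. -/
def SpecConfig (R : Config → ℕ → Prop) : Config → ℕ → Prop
  | .run P H, b => Spec P H b R
  | .done H, b => R (.done H) b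
  | .failed, b => R .failed b

/-- `C` is the part of `P` whose executions occur in the premises of transitions of `P`. -/
inductive Com.Sub : Com → Com → Prop
  | seq {P Q : Com} : Com.Sub (.seq P Q) P
  | ifCond {C P Q : Com} : Com.Sub (.ifte C P Q) C
  | tryCond {C P Q : Com} : Com.Sub (.tryte C P Q) C
  | body {P : Com} : Com.Sub (.loop P) P

theorem Steps.of_done {H : HostGraph} {c : Config} {t : ℕ} (h : Steps (.done H) c t) :
    c = .done H ∧ t = 0 := by
  cases h; exact ⟨rfl, rfl⟩

theorem Steps.of_failed {c : Config} {t : ℕ} (h : Steps .failed c t) :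
    c = .failed ∧ t = 0 := by
  cases h; exact ⟨rfl, rfl⟩

/-- An execution is split at its first transition. Unfinished executions in the premises of a
transition are invisible to `Step`, so `hsub` bounds them separately. -/
theorem Spec.of_step {P : Com} {G : HostGraph} {B : ℕ} {R : Config → ℕ → Prop}
    (hne : ∃ c t, Step P G c t) (hsub : ∀ C t, P.Sub C → Spends C G t → t ≤ B)
    (h : ∀ c t, Step P G c t → ∃ b, t + b ≤ B ∧ SpecConfig R c b) : Spec P G B R where
  time t ht := by
    cases ht with
    | zero => exact Nat.zero_le _
    | last hs => obtain ⟨b, hb, -⟩ := h _ _ hs; omega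
    | step hs ht' =>
      obtain ⟨b, hb, hS⟩ := h _ _ hs
      have := Spec.time hS _ ht'
      omega
    | seq hs => exact hsub _ _ .seq hs
    | ifCond hs => exact hsub _ _ .ifCond hs
    | tryCond hs => exact hsub _ _ .tryCond hs
    | body hs => exact hsub _ _ .body hs
  post c t ht hc := by
    cases ht with
    | refl =>
      obtain ⟨c, t, hs⟩ := hne
      obtain rfl : P = .brk := hc
      exact absurd hs not_step_brk
    | @head _ _ c' _ t₁ t₂ hs ht' =>
      obtain ⟨b, hb, hS⟩ := h _ _ hs
      cases c' with
      | run P' H =>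
        obtain ⟨b', hb', hR⟩ := Spec.post hS _ _ ht' hc
        exact ⟨b', by omega, hR⟩
      | done H => obtain ⟨rfl, rfl⟩ := ht'.of_done; exact ⟨b, by omega, hS⟩
      | failed => obtain ⟨rfl, rfl⟩ := ht'.of_failed; exact ⟨b, by omega, hS⟩
  live Q H t ht := by
    cases ht with
    | refl => exact .inr hne
    | @head _ _ c' _ t₁ t₂ hs ht' =>
      obtain ⟨b, hb, hS⟩ := h _ _ hs
      cases c' with
      | run P' H => exact Spec.live hS _ _ _ ht'
      | done H => exact absurd ht'.of_done.1 nofun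
      | failed => exact absurd ht'.of_failed.1 nofun

theorem Step.spends {P : Com} {G : HostGraph} {c : Config} {t : ℕ} (h : Step P G c t) :
    Spends P G t := .last h

namespace Spec

variable {P Q C : Com} {G : HostGraph} {B B' : ℕ} {R R' : Config → ℕ → Prop}

theorem mono (h : Spec P G B R) (hB : B ≤ B') (hR : ∀ c b, R c b → R' c b) :
    Spec P G B' R' where
  time t ht := (h.time t ht).trans hB
  post c t ht hc := by
    obtain ⟨b, hb, hr⟩ := h.post c t ht hc
    exact ⟨b, hb.trans hB, hR _ _ hr⟩
  live := h.live

theorem mono_budget (h : Spec P G B R) (hB : B ≤ B') : Spec P G B' R := h.mono hB fun _ _ => id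

/-- The specification holds, with the remaining budget, after a transition. -/
theorem step (h : Spec P G B R) {P' : Com} {H : HostGraph} {t : ℕ}
    (hs : Step P G (.run P' H) t) : Spec P' H (B - t) R where
  time t' ht := by have := h.time _ (.step hs ht); omega
  post c t' ht hc := by
    obtain ⟨b, hb, hr⟩ := h.post c _ (.head hs ht) hc
    exact ⟨b, by omega, hr⟩
  live Q' H' t' ht := h.live _ _ _ (.head hs ht)

theorem exists_step (h : Spec P G B R) : P = .brk ∨ ∃ c t, Step P G c t := h.live P G 0 .refl

/-- Every transition uses up part of a finite budget. This yields liveness of branchings and loops,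
which have a transition only when their condition or body has a finished execution. -/
theorem exists_final (h : Spec P G B R) : ∃ c t, Steps (.run P G) c t ∧ c.Final := by
  induction B using Nat.strong_induction_on generalizing P G with
  | _ B ih =>
    obtain rfl | ⟨c, t, hs⟩ := h.exists_step
    · exact ⟨_, _, .refl, rfl⟩
    · cases c with
      | run P' H =>
        have h1 := hs.time_pos
        have h2 := h.time _ hs.spends
        obtain ⟨c, t', hc, hf⟩ := ih (B - t) (by omega) (h.step hs)
        exact ⟨c, _, .head hs hc, hf⟩
      | done H => exact ⟨_, _, .head hs .refl, trivial⟩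
      | failed => exact ⟨_, _, .head hs .refl, trivial⟩

theorem brk (h : R (.run .brk G) B) : Spec .brk G B R where
  time t ht := by
    cases ht with
    | zero => exact Nat.zero_le _
    | last hs => exact absurd hs not_step_brk
    | step hs => exact absurd hs not_step_brk
  post c t ht _ := by
    cases ht with
    | refl => exact ⟨B, by omega, h⟩
    | head hs => exact absurd hs not_step_brk
  live Q H t ht := by
    cases ht with
    | refl => exact .inl rfl
    | head hs => exact absurd hs not_step_brk

theorem skip (h : R (.done G) B) : Spec .skip G (B + 1) R := by
  refine of_step ⟨_, _, .skip⟩ (fun C t hC => by cases hC) ?_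
  rintro c t ⟨⟩
  exact ⟨B, by omega, h⟩

theorem fail (h : R .failed B) : Spec .fail G (B + 1) R := by
  refine of_step ⟨_, _, .fail⟩ (fun C t hC => by cases hC) ?_
  rintro c t ⟨⟩
  exact ⟨B, by omega, h⟩

theorem call {rs : List Rule} {K : ℕ} (hK : ∀ r ∈ rs, callTime rs G + r.replaceTime ≤ K)
    (hK' : callTime rs G ≤ K) (h : ∀ r ∈ rs, ∀ H, r.Applies G H → R (.done H) B)
    (hf : (∀ r ∈ rs, ∀ H, ¬ r.Applies G H) → R .failed B) :
    Spec (.call rs) G (K + B) R := by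
  refine of_step ?_ (fun C t hC => by cases hC) ?_
  · by_cases ha : ∀ r ∈ rs, ∀ H, ¬ r.Applies G H
    · exact ⟨_, _, .call₂ ha⟩
    · push Not at ha
      obtain ⟨r, hr, H, hH⟩ := ha
      exact ⟨_, _, .call₁ hr hH⟩
  · intro c t hs
    cases hs with
    | call₁ hr hH => exact ⟨B, by have := hK _ hr; omega, h _ hr _ hH⟩
    | call₂ ha => exact ⟨B, by omega, hf ha⟩

/-- What the first part of `P; Q` has to achieve for `P; Q` to achieve `R`. -/
def seqPost (Q : Com) (R : Config → ℕ → Prop) : Config → ℕ → Prop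
  | .done H, b => Spec Q H b R
  | .failed, b => R .failed b
  | .run _ H, b => ∃ b', b = b' + 1 ∧ R (.run .brk H) b'

theorem seq (h : Spec P G B (seqPost Q R)) : Spec (.seq P Q) G B R := by
  induction B using Nat.strong_induction_on generalizing P G with
  | _ B ih =>
    refine of_step ?_ ?_ ?_
    · obtain rfl | ⟨c, t, hs⟩ := h.exists_step
      · exact ⟨_, _, .brk⟩
      · cases c with
        | run P' H => exact ⟨_, _, .seq₁ hs⟩
        | done H => exact ⟨_, _, .seq₂ hs⟩
        | failed => exact ⟨_, _, .seq₃ hs⟩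
    · rintro C t ⟨⟩ ht
      exact h.time _ ht
    · intro c t hs
      cases hs with
      | seq₁ hs =>
        have h1 := hs.time_pos
        have h2 := h.time _ hs.spends
        exact ⟨B - t, by omega, ih _ (by omega) (h.step hs)⟩
      | seq₂ hs => exact h.post _ _ (.head hs .refl) trivial
      | seq₃ hs => exact h.post _ _ (.head hs .refl) trivial
      | brk =>
        obtain ⟨b, hb, b', rfl, hR⟩ := h.post _ _ .refl rfl
        exact ⟨b' , by omega, brk hR⟩

/-- What the condition of `try C then P else Q` has to achieve for the command to achieve `R`. -/
def tryPost (G : HostGraph) (P Q : Com) (R : Config → ℕ → Prop) : Config → ℕ → Prop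
  | .done H, b => Spec P H b R
  | .failed, b => Spec Q G b R
  -- A condition that ends in `break` offers the branching command no transition.
  | .run _ _, _ => False

theorem tryte (h : Spec C G B (tryPost G P Q R)) : Spec (.tryte C P Q) G (B + 1) R := by
  refine of_step ?_ ?_ ?_
  · obtain ⟨c, t, hc, hf⟩ := h.exists_final
    cases c with
    | run P' H => obtain ⟨b, -, hb⟩ := h.post _ _ hc hf; exact hb.elim
    | done H => exact ⟨_, _, .try₁ hc⟩
    | failed => exact ⟨_, _, .try₂ hc⟩
  · rintro C t ⟨⟩ ht
    have := h.time _ ht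
    omega
  · intro c t hs
    cases hs with
    | try₁ hs => obtain ⟨b, hb, hS⟩ := h.post _ _ hs trivial; exact ⟨b, by omega, hS⟩
    | try₂ hs => obtain ⟨b, hb, hS⟩ := h.post _ _ hs trivial; exact ⟨b, by omega, hS⟩

/-- What the condition of `if C then P else Q` has to achieve for the command to achieve `R`. -/
def ifPost (G : HostGraph) (P Q : Com) (R : Config → ℕ → Prop) : Config → ℕ → Prop
  | .done _, b => Spec P G b R
  | .failed, b => Spec Q G b R
  | .run _ _, _ => False

theorem ifte (h : Spec C G B (ifPost G P Q R)) : Spec (.ifte C P Q) G (B + 1) R := by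
  refine of_step ?_ ?_ ?_
  · obtain ⟨c, t, hc, hf⟩ := h.exists_final
    cases c with
    | run P' H => obtain ⟨b, -, hb⟩ := h.post _ _ hc hf; exact hb.elim
    | done H => exact ⟨_, _, .if₁ hc⟩
    | failed => exact ⟨_, _, .if₂ hc⟩
  · rintro C t ⟨⟩ ht
    have := h.time _ ht
    omega
  · intro c t hs
    cases hs with
    | if₁ hs => obtain ⟨b, hb, hS⟩ := h.post _ _ hs trivial; exact ⟨b, by omega, hS⟩
    | if₂ hs => obtain ⟨b, hb, hS⟩ := h.post _ _ hs trivial; exact ⟨b, by omega, hS⟩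

/-- What the body of a loop with invariant `I`, run on `H`, has to achieve for the loop to
achieve `R`. -/
def loopPost (I : HostGraph → ℕ → Prop) (H : HostGraph) (R : Config → ℕ → Prop) :
    Config → ℕ → Prop
  | .done H', b => I H' b
  | .failed, b => R (.done H) b
  | .run _ H', b => R (.done H') b

/-- The budget itself is the variant, since each round uses at least one unit. As `I` speaks of the
budget too, it can tie the remaining credit to a potential of the graph. -/
theorem loop (I : HostGraph → ℕ → Prop)
    (hI : ∀ H b, I H b → ∃ b', b' + 1 ≤ b ∧ Spec P H b' (loopPost I H R)) (h : I G B) :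
    Spec (.loop P) G B R := by
  induction B using Nat.strong_induction_on generalizing G with
  | _ B ih =>
    obtain ⟨b, hb, hS⟩ := hI _ _ h
    refine of_step ?_ ?_ ?_
    · obtain ⟨c, t, hc, hf⟩ := hS.exists_final
      cases c with
      | run P' H =>
        obtain rfl : P' = .brk := hf
        exact ⟨_, _, .alap₃ hc⟩
      | done H => exact ⟨_, _, .alap₁ hc⟩
      | failed => exact ⟨_, _, .alap₂ hc⟩
    · rintro C t ⟨⟩ ht
      have := hS.time _ ht
      omega
    · intro c t hs
      cases hs with
      | alap₁ hs =>
        obtain ⟨b', hb', hI'⟩ := hS.post _ _ hs trivial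
        exact ⟨b', by omega, ih _ (by omega) hI'⟩
      | alap₂ hs => obtain ⟨b', hb', hR⟩ := hS.post _ _ hs trivial; exact ⟨b', by omega, hR⟩
      | alap₃ hs => obtain ⟨b', hb', hR⟩ := hS.post _ _ hs rfl; exact ⟨b', by omega, hR⟩

/-- An infinite sequence would contain `B + 1` transitions, each taking at least one unit. -/
theorem not_canDiverge (h : Spec P G B R) : ¬ CanDiverge P G := by
  rintro ⟨f, hf0, hf⟩
  have key : ∀ n i, ∃ t, n ≤ t ∧ Spends (f i).1 (f i).2 t := by
    intro n
    induction n with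
    | zero => exact fun i => ⟨0, le_rfl, .zero⟩
    | succ n ih =>
      intro i
      obtain ⟨t, ht⟩ := hf i
      obtain ⟨t', hn, ht'⟩ := ih (i + 1)
      exact ⟨t + t', by have := ht.time_pos; omega, .step ht ht'⟩
  obtain ⟨t, ht, hs⟩ := key (B + 1) 0
  rw [hf0] at hs
  have := h.time _ hs
  omega

theorem not_canGetStuck (h : Spec P G B R) (hR : ∀ H b, ¬ R (.run .brk H) b) :
    ¬ CanGetStuck P G := by
  rintro ⟨Q, H, t, hs, hQ⟩
  obtain rfl | ⟨c, t', hc⟩ := h.live _ _ _ hs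
  · obtain ⟨b, -, hb⟩ := h.post _ _ hs rfl
    exact hR _ _ hb
  · exact hQ _ _ hc

end Spec

end GP2

namespace GP2

/-! # The effect of a rule application on weights -/

/-- Weights of node attributes, and of the marks of outgoing and of incoming edges. -/
structure Weight where
  node : NodeAttr → ℕ
  out : EdgeMark → ℕ
  inc : EdgeMark → ℕ

namespace Weight

/-- The contribution of an edge to the weight at the node `v`. -/
def edge (w : Weight) (v : ℕ) (e : Edge) : ℕ :=
  (if e.src = v then w.out e.mark else 0) + (if e.tgt = v then w.inc e.mark else 0)

/-- The weight of the node `v`. -/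
def loc (w : Weight) (G : HostGraph) (v : ℕ) : ℕ :=
  w.node (G.attr v) + (G.edges.map (w.edge v)).sum

/-- The weight of a node of an instantiated rule graph. -/
def pat (w : Weight) {n : ℕ} (P : Pattern n) (ι : Inst) (i : Fin n) : ℕ :=
  w.node ((P.node i).inst ι) + ((P.instEdges ι Fin.val).map (w.edge i)).sum

end Weight

-- Comparing weights in the host graph with weights in the rule graphs

/-- The direction of a bidirectional edge depends on `ι` alone and not on the placement. Incidences
in the host graph can thus be read off from the rule graph placed at its own node numbers by
`Fin.val`. -/
theorem EdgePat.inst_src {n : ℕ} (ι : Inst) (g : Fin n → ℕ) (e : EdgePat n) :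
    ∃ i j, e.inst ι g = ⟨g i, g j, e.label.inst ι, e.mark⟩ ∧
      e.inst ι Fin.val = ⟨i, j, e.label.inst ι, e.mark⟩ := by
  unfold EdgePat.inst
  split
  · exact ⟨_, _, rfl, rfl⟩
  · exact ⟨_, _, rfl, rfl⟩

theorem Weight.sum_instEdges (w : Weight) {n : ℕ} (P : Pattern n) (ι : Inst) {g : Fin n → ℕ}
    (hg : Function.Injective g) (i : Fin n) :
    ((P.instEdges ι g).map (w.edge (g i))).sum =
      ((P.instEdges ι Fin.val).map (w.edge i)).sum := by
  simp only [Pattern.instEdges, Multiset.map_coe, List.map_map]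
  congr 2
  refine List.map_congr_left fun e _ => ?_
  obtain ⟨s, t, h1, h2⟩ := e.inst_src ι g
  simp [Weight.edge, h1, h2, hg.eq_iff, Fin.val_inj]

theorem Weight.sum_instEdges_of_notMem (w : Weight) {n : ℕ} (P : Pattern n) (ι : Inst)
    {g : Fin n → ℕ} {v : ℕ} (hv : v ∉ Set.range g) :
    ((P.instEdges ι g).map (w.edge v)).sum = 0 := by
  simp only [Pattern.instEdges, Multiset.map_coe, List.map_map, Multiset.sum_coe]
  refine List.sum_eq_zero fun x hx => ?_
  obtain ⟨e, -, rfl⟩ := List.mem_map.1 hx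
  obtain ⟨s, t, h1, -⟩ := e.inst_src ι g
  have hs : g s ≠ v := fun h => hv ⟨s, h⟩
  have ht : g t ≠ v := fun h => hv ⟨t, h⟩
  simp [Weight.edge, h1, hs, ht]

theorem Weight.sum_edges_of_notMem (w : Weight) {G : HostGraph} {v : ℕ} (hv : v ∉ G.nodes) :
    (G.edges.map (w.edge v)).sum = 0 := by
  refine Multiset.sum_eq_zero fun x hx => ?_
  obtain ⟨e, he, rfl⟩ := Multiset.mem_map.1 hx
  have h := G.incident e he
  have hs : e.src ≠ v := fun h' => hv (h' ▸ h.1)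
  have ht : e.tgt ≠ v := fun h' => hv (h' ▸ h.2)
  simp [Weight.edge, hs, ht]

namespace Rule.AppliesVia

variable {r : Rule} {G H : HostGraph} {ι : Inst} {g : Fin (r.k + r.j) → ℕ}

/-- The replacement of edges without truncated subtraction, so that any sum over edges can be taken
on both sides. -/
theorem edges_add (h : r.AppliesVia G H ι g) :
    H.edges + r.L.instEdges ι (fun i => g (Fin.castAdd r.j i)) =
      G.edges + r.R.instEdges ι g := by
  rw [h.edges, add_right_comm, tsub_add_cancel_of_le h.isMatch.edges]

theorem sum_edges_add (h : r.AppliesVia G H ι g) (f : Edge → ℕ) :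
    (H.edges.map f).sum + ((r.L.instEdges ι (fun i => g (Fin.castAdd r.j i))).map f).sum =
      (G.edges.map f).sum + ((r.R.instEdges ι g).map f).sum := by
  rw [← Multiset.sum_add, ← Multiset.map_add, h.edges_add, Multiset.map_add, Multiset.sum_add]

/-- The change of the weight at a preserved node. -/
theorem loc_castAdd (h : r.AppliesVia G H ι g) (w : Weight) (i : Fin r.k) :
    w.loc H (g (Fin.castAdd r.j i)) + w.pat r.L ι i =
      w.loc G (g (Fin.castAdd r.j i)) + w.pat r.R ι (Fin.castAdd r.j i) := by
  have h1 := h.sum_edges_add (w.edge (g (Fin.castAdd r.j i)))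
  rw [w.sum_instEdges r.L ι (g := fun i => g (Fin.castAdd r.j i)) h.isMatch.injective i,
    w.sum_instEdges r.R ι h.injective] at h1
  unfold Weight.loc Weight.pat
  rw [h.attr, h.isMatch.attr]
  omega

/-- The weight at a created node. -/
theorem loc_natAdd (h : r.AppliesVia G H ι g) (w : Weight) (i : Fin r.j) :
    w.loc H (g (Fin.natAdd r.k i)) = w.pat r.R ι (Fin.natAdd r.k i) := by
  have h1 := h.sum_edges_add (w.edge (g (Fin.natAdd r.k i)))
  rw [w.sum_instEdges_of_notMem r.L, w.sum_instEdges r.R ι h.injective,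
    w.sum_edges_of_notMem (h.fresh i)] at h1
  · unfold Weight.loc Weight.pat
    rw [h.attr]
    omega
  · rintro ⟨i', hi'⟩
    exact h.fresh i (hi' ▸ h.isMatch.mem i')

/-- The weight at a node outside of the match is unchanged. -/
theorem loc_of_notMem (h : r.AppliesVia G H ι g) (w : Weight) {v : ℕ} (hv : v ∉ Set.range g) :
    w.loc H v = w.loc G v := by
  have h1 := h.sum_edges_add (w.edge v)
  rw [w.sum_instEdges_of_notMem r.L, w.sum_instEdges_of_notMem r.R ι hv] at h1
  · unfold Weight.loc
    rw [h.attr_of_notMem v hv]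
    omega
  · rintro ⟨i', hi'⟩
    exact hv ⟨_, hi'⟩

theorem mem_nodes (h : r.AppliesVia G H ι g) {v : ℕ} (hv : v ∈ H.nodes) :
    (∃ i, v = g (Fin.castAdd r.j i) ∧ v ∈ G.nodes) ∨ (∃ i, v = g (Fin.natAdd r.k i)) ∨
      v ∉ Set.range g ∧ v ∈ G.nodes := by
  by_cases hr : v ∈ Set.range g
  · obtain ⟨i, rfl⟩ := hr
    refine Fin.addCases (fun i => ?_) (fun i => ?_) i
    · exact .inl ⟨i, rfl, h.isMatch.mem i⟩
    · exact .inr (.inl ⟨i, rfl⟩)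
  · rw [h.nodes, Finset.mem_union] at hv
    refine .inr (.inr ⟨hr, hv.resolve_right fun hv => hr ?_⟩)
    obtain ⟨i, -, hi⟩ := Finset.mem_image.1 hv
    exact ⟨i, hi⟩

/-- Upper bounds of weights are preserved. -/
theorem loc_le (h : r.AppliesVia G H ι g) (w : Weight) {m : ℕ}
    (hk : ∀ i : Fin r.k, w.pat r.R ι (Fin.castAdd r.j i) ≤ w.pat r.L ι i)
    (hj : ∀ i : Fin r.j, w.pat r.R ι (Fin.natAdd r.k i) ≤ m)
    (hG : ∀ v ∈ G.nodes, w.loc G v ≤ m) : ∀ v ∈ H.nodes, w.loc H v ≤ m := by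
  intro v hv
  obtain ⟨i, rfl, hv⟩ | ⟨i, rfl⟩ | ⟨hr, hv⟩ := h.mem_nodes hv
  · have h1 := h.loc_castAdd w i
    have h2 := hk i
    have h3 := hG _ hv
    omega
  · exact (h.loc_natAdd w i).trans_le (hj i)
  · exact (h.loc_of_notMem w hr).trans_le (hG v hv)

/-- Lower bounds of weights are preserved. -/
theorem le_loc (h : r.AppliesVia G H ι g) (w : Weight) {m : ℕ}
    (hk : ∀ i : Fin r.k, w.pat r.L ι i ≤ w.pat r.R ι (Fin.castAdd r.j i))
    (hj : ∀ i : Fin r.j, m ≤ w.pat r.R ι (Fin.natAdd r.k i))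
    (hG : ∀ v ∈ G.nodes, m ≤ w.loc G v) : ∀ v ∈ H.nodes, m ≤ w.loc H v := by
  intro v hv
  obtain ⟨i, rfl, hv⟩ | ⟨i, rfl⟩ | ⟨hr, hv⟩ := h.mem_nodes hv
  · have h1 := h.loc_castAdd w i
    have h2 := hk i
    have h3 := hG _ hv
    omega
  · exact (hj i).trans_eq (h.loc_natAdd w i).symm
  · exact (hG v hv).trans_eq (h.loc_of_notMem w hr).symm

end Rule.AppliesVia

/-- Weights of node attributes, and of the labels and marks of edges. -/
structure TotalWeight where
  node : NodeAttr → ℕ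
  edge : Label → EdgeMark → ℕ

namespace TotalWeight

/-- The total weight of a graph. -/
def tot (w : TotalWeight) (G : HostGraph) : ℕ :=
  ∑ v ∈ G.nodes, w.node (G.attr v) + (G.edges.map fun e => w.edge e.label e.mark).sum

/-- The total weight of an instantiated rule graph. -/
def pat (w : TotalWeight) {n : ℕ} (P : Pattern n) (ι : Inst) : ℕ :=
  ∑ i, w.node ((P.node i).inst ι) + (P.edges.map fun e => w.edge (e.label.inst ι) e.mark).sum

theorem sum_instEdges (w : TotalWeight) {n : ℕ} (P : Pattern n) (ι : Inst) (g : Fin n → ℕ) :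
    ((P.instEdges ι g).map fun e => w.edge e.label e.mark).sum =
      (P.edges.map fun e => w.edge (e.label.inst ι) e.mark).sum := by
  simp only [Pattern.instEdges, Multiset.map_coe, List.map_map, Multiset.sum_coe]
  congr 1
  refine List.map_congr_left fun e _ => ?_
  obtain ⟨s, t, h1, -⟩ := e.inst_src ι g
  simp [h1]

end TotalWeight

/-- The change of the total weight of a graph. -/
theorem Rule.AppliesVia.tot {r : Rule} {G H : HostGraph} {ι : Inst} {g : Fin (r.k + r.j) → ℕ}
    (h : r.AppliesVia G H ι g) (w : TotalWeight) :
    w.tot H + w.pat r.L ι = w.tot G + w.pat r.R ι := by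
  have h1 := h.sum_edges_add fun e => w.edge e.label e.mark
  rw [w.sum_instEdges, w.sum_instEdges] at h1
  -- The nodes outside the match, which contribute the same to both totals.
  set S := G.nodes.filter (· ∉ Set.range g)
  have h2 : ∑ v ∈ H.nodes, w.node (H.attr v) =
      ∑ v ∈ S, w.node (G.attr v) + ∑ i, w.node ((r.R.node i).inst ι) := by
    have : H.nodes = S ∪ Finset.univ.image g := by
      ext v
      rw [h.nodes]
      by_cases hv : v ∈ Set.range g <;> simp_all [S]
    rw [this, Finset.sum_union, Finset.sum_image h.injective.injOn]
    · simp only [h.attr]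
      congr 1
      refine Finset.sum_congr rfl fun v hv => ?_
      rw [h.attr_of_notMem v (Finset.mem_filter.1 hv).2]
    · rw [Finset.disjoint_left]
      intro v hv hv'
      obtain ⟨i, -, rfl⟩ := Finset.mem_image.1 hv'
      exact (Finset.mem_filter.1 hv).2 ⟨i, rfl⟩
  have h3 : ∑ v ∈ G.nodes, w.node (G.attr v) =
      ∑ v ∈ S, w.node (G.attr v) + ∑ i, w.node ((r.L.node i).inst ι) := by
    have : G.nodes = S ∪ Finset.univ.image fun i => g (Fin.castAdd r.j i) := by
      ext v
      by_cases hv : v ∈ Set.range g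
      · obtain ⟨i, rfl⟩ := hv
        simp only [S, Finset.mem_union, Finset.mem_filter, Set.mem_range_self, not_true_eq_false,
          and_false, false_or, Finset.mem_image, Finset.mem_univ, true_and]
        refine Fin.addCases (fun i => ?_) (fun i => ?_) i
        · exact iff_of_true (h.isMatch.mem i) ⟨i, rfl⟩
        · refine iff_of_false (h.fresh i) ?_
          rintro ⟨i', hi'⟩
          exact h.fresh i (hi' ▸ h.isMatch.mem i')
      · have : ∀ i, g (Fin.castAdd r.j i) ≠ v := fun i hi => hv ⟨_, hi⟩
        simp_all [S]
    conv_lhs => rw [this]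
    rw [Finset.sum_union, Finset.sum_image h.isMatch.injective.injOn]
    · simp only [h.isMatch.attr]
    · rw [Finset.disjoint_left]
      intro v hv hv'
      obtain ⟨i, -, rfl⟩ := Finset.mem_image.1 hv'
      exact (Finset.mem_filter.1 hv).2 ⟨_, rfl⟩
  unfold TotalWeight.tot TotalWeight.pat
  omega

/-- A rule that creates no nodes is applicable wherever its left-hand side matches. -/
theorem Pattern.IsMatch.exists_applies {r : Rule} (hj : r.j = 0) {G : HostGraph} {ι : Inst}
    {g : Fin r.k → ℕ} (h : r.L.IsMatch G ι g) : ∃ H, r.Applies G H := by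
  obtain ⟨k, j, L, R⟩ := r
  obtain rfl : j = 0 := hj
  have hmem : ∀ e ∈ G.edges - L.instEdges ι g + R.instEdges ι (g : Fin (k + 0) → ℕ),
      e.src ∈ G.nodes ∧ e.tgt ∈ G.nodes := by
    intro e he
    obtain he | he := Multiset.mem_add.1 he
    · exact G.incident e (Multiset.mem_of_le (Multiset.sub_le_self _ _) he)
    · obtain ⟨e', -, rfl⟩ := List.mem_map.1 (Multiset.mem_coe.1 he)
      obtain ⟨s, t, h1, -⟩ := e'.inst_src ι (g : Fin (k + 0) → ℕ)
      rw [h1]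
      exact ⟨h.mem s, h.mem t⟩
  classical
  let attr : ℕ → NodeAttr := fun v =>
    if hv : ∃ i : Fin (k + 0), g i = v then (R.node hv.choose).inst ι else G.attr v
  refine ⟨⟨G.nodes, attr, _, hmem⟩, ι, g, h.injective, h, fun i => i.elim0, ?_, ?_, ?_, rfl⟩
  · refine (Finset.union_eq_left.2 fun v hv => ?_).symm
    obtain ⟨i, -, rfl⟩ := Finset.mem_image.1 hv
    exact h.mem i
  · intro i
    have hv : ∃ i' : Fin (k + 0), g i' = g i := ⟨i, rfl⟩
    have h2 : hv.choose = i := h.injective hv.choose_spec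
    change dite _ _ _ = _
    rw [dif_pos hv, h2]
  · intro v hv
    exact dif_neg hv

end GP2

namespace GP2

/-! # The time to search for matches -/

/-- The instruction does not go through all nodes of the host graph. -/
def SearchOp.isLocal {n : ℕ} : SearchOp n → Bool
  | .node _ => false
  | _ => true

/-- The plan for the left-hand side is short and avoids searching all nodes. -/
def Rule.IsFast (r : Rule) : Prop :=
  -- The bounds 4 and 13 are attained by `forward2` and `back_push`.
  r.L.plan.all SearchOp.isLocal = true ∧ r.L.plan.length ≤ 4 ∧ r.replaceTime ≤ 13

/-- The number of roots and the degrees are at most `M`. -/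
structure HostGraph.Bounded (G : HostGraph) (M : ℕ) : Prop where
  roots : G.roots.card ≤ M
  degree : ∀ v, G.degree v ≤ M

theorem EdgePat.card_candidates_le {n : ℕ} (e : EdgePat n) (b : Bool) (outs ins : Multiset Edge) :
    Multiset.card (e.candidates b outs ins) ≤ Multiset.card outs + Multiset.card ins := by
  unfold EdgePat.candidates
  dsimp only
  split_ifs <;> simp

theorem EdgePat.card_candidates_filter_le {n : ℕ} (e : EdgePat n) (b : Bool) {G : HostGraph}
    {M : ℕ} (hG : G.Bounded M) (U : Multiset Edge) (v : ℕ) (p : Edge × ℕ → Prop)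
    [DecidablePred p] :
    Multiset.card ((e.candidates b ((G.edges - U).filter fun h => h.src = v)
      ((G.edges - U).filter fun h => h.tgt = v)).filter p) ≤ M := by
  refine (Multiset.card_le_card (Multiset.filter_le _ _)).trans
    ((e.card_candidates_le _ _ _).trans (le_trans ?_ (hG.degree v)))
  have h := Multiset.sub_le_self G.edges U
  exact add_le_add (Multiset.card_le_card (Multiset.filter_le_filter _ h))
    (Multiset.card_le_card (Multiset.filter_le_filter _ h))

theorem one_add_add_le_pow {M c s l : ℕ} (hc : c ≤ M) (hs : s ≤ M * (2 * M + 1) ^ l) :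
    1 + c + s ≤ (2 * M + 1) ^ (l + 1) := by
  have h1 : 1 ≤ (2 * M + 1) ^ l := Nat.one_le_pow _ _ (by omega)
  rw [pow_succ]
  nlinarith

/-- A local instruction inspects at most `M` items and branches into at most `M` continuations. With
a bound `X ≥ 1` for each of these, one level costs at most `1 + M + M * X ≤ (2 * M + 1) * X`. -/
theorem searchTime_le {n : ℕ} (P : Pattern n) {G : HostGraph} {M : ℕ} (hG : G.Bounded M) :
    ∀ (ops : List (SearchOp n)) (s : SearchState n), ops.all SearchOp.isLocal = true →
      searchTime P G ops s ≤ (2 * M + 1) ^ ops.length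
  | [], s, _ => by simp [searchTime]
  | .root i :: ops, s, h => by
    rw [searchTime, List.length_cons]
    refine one_add_add_le_pow hG.roots ?_
    refine (Finset.sum_le_card_nsmul _ _ _ fun v _ =>
      searchTime_le P hG ops _ (by simp_all)).trans ?_
    rw [smul_eq_mul]
    exact Nat.mul_le_mul_right _ ((Finset.card_filter_le _ _).trans hG.roots)
  | .node i :: ops, s, h => by simp [SearchOp.isLocal] at h
  | .fromSrc e :: ops, s, h => by
    rw [searchTime, List.length_cons]
    split
    · exact Nat.one_le_pow _ _ (by omega)
    · refine one_add_add_le_pow ((e.card_candidates_le _ _ _).trans (hG.degree _)) ?_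
      refine (Multiset.sum_le_card_nsmul _ ((2 * M + 1) ^ ops.length) fun x hx => ?_).trans ?_
      · obtain ⟨c, -, rfl⟩ := Multiset.mem_map.1 hx
        exact searchTime_le P hG ops _ (by simp_all)
      · rw [smul_eq_mul, Multiset.card_map]
        exact Nat.mul_le_mul_right _ (e.card_candidates_filter_le _ hG _ _ _)
  | .fromTgt e :: ops, s, h => by
    rw [searchTime, List.length_cons]
    split
    · exact Nat.one_le_pow _ _ (by omega)
    · refine one_add_add_le_pow ((e.card_candidates_le _ _ _).trans (hG.degree _)) ?_
      refine (Multiset.sum_le_card_nsmul _ ((2 * M + 1) ^ ops.length) fun x hx => ?_).trans ?_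
      · obtain ⟨c, -, rfl⟩ := Multiset.mem_map.1 hx
        exact searchTime_le P hG ops _ (by simp_all)
      · rw [smul_eq_mul, Multiset.card_map]
        exact Nat.mul_le_mul_right _ (e.card_candidates_filter_le _ hG _ _ _)

/-- A bound for the time of a call of at most three fast rules in a bounded graph. -/
def callBound (M : ℕ) : ℕ := 3 * (2 * M + 1) ^ 4 + 14

theorem callTime_le {rs : List Rule} (hrs : ∀ r ∈ rs, r.IsFast) (hl : rs.length ≤ 3)
    {G : HostGraph} {M : ℕ} (hG : G.Bounded M) : callTime rs G + 13 ≤ callBound M := by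
  have h : (rs.map fun r => r.matchTime G).sum ≤ rs.length * (2 * M + 1) ^ 4 := by
    refine (List.sum_le_card_nsmul _ ((2 * M + 1) ^ 4) fun x hx => ?_).trans_eq (by simp)
    obtain ⟨r, hr, rfl⟩ := List.mem_map.1 hx
    exact (searchTime_le _ hG _ _ (hrs r hr).1).trans
      (Nat.pow_le_pow_right (by omega) (hrs r hr).2.1)
  have h' := h.trans (Nat.mul_le_mul_right _ hl)
  unfold callTime callBound
  omega

theorem Spec.call_fast {rs : List Rule} (hrs : ∀ r ∈ rs, r.IsFast) (hl : rs.length ≤ 3)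
    {G : HostGraph} {M B : ℕ} {R : Config → ℕ → Prop} (hG : G.Bounded M)
    (h : ∀ r ∈ rs, ∀ H, r.Applies G H → R (.done H) B)
    (hf : (∀ r ∈ rs, ∀ H, ¬ r.Applies G H) → R .failed B) :
    Spec (.call rs) G (callBound M + B) R := by
  have h1 := callTime_le hrs hl hG
  refine Spec.call (fun r hr => ?_) (by omega) h hf
  have := (hrs r hr).2.2
  omega

end GP2

namespace GP2.TopSort

/-! # The effect of the rules of `top-sort`

The argument `first` of the weights below distinguishes the two phases of the program: before and
after `unroot`. -/

/-- The degree, with a reserve for the red and blue edges that a node may still get. -/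
def degWeight (first : Bool) : Weight where
  node a := match a.mark with
    | .none => 2
    | .red => 2
    | .green => if a.label = [] then 1 else 0
    | .blue => 0
    -- An unvisited node may get two red edges on the stack of visited nodes and later two blue
    -- edges in the sorted list. Becoming red pays for the former and leaves 2, becoming blue pays
    -- for the latter and leaves 0. A green node with the empty label still needs 1 for its first
    -- blue edge.
    | .grey => if first then 4 else 2
  out _ := 1
  inc _ := 1

/-- The number of incoming blue edges, with a reserve of one for nodes that are not blue. -/
def blueInWeight : Weight where
  node a := if a.mark = .blue then 0 else 1
  out _ := 0
  inc m := if m = .blue then 1 else 0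

/-- The number of outgoing blue edges, which only green nodes labelled with 0 are required to
have. -/
def blueOutWeight : Weight where
  node a := if a.mark = .green ∧ a.label = [Sum.inl 0] then 0 else 1
  out m := if m = .blue then 1 else 0
  inc _ := 0

/-- The number of blue edges with a nonempty label. -/
def labelledBlue : TotalWeight where
  node _ := 0
  edge l m := if m = .blue ∧ l ≠ [] then 1 else 0

/-- The number of roots. -/
def rootCount : TotalWeight where
  node a := if a.root then 1 else 0
  edge _ _ := 0

/-- The size of the graph. -/
def sizeWeight : TotalWeight where
  node _ := 1
  edge _ _ := 1

/-- The number of green roots with a label that is empty or 0. -/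
def greenRootCount : TotalWeight where
  node a := if a.root ∧ a.mark = .green ∧ (a.label = [] ∨ a.label = [Sum.inl 0]) then 1 else 0
  edge _ _ := 0

/-- A quantity that decreases with the applications of rules. -/
def potential (first : Bool) : TotalWeight where
  node a := match a.mark with
    | .red => 2
    -- In the first phase, turning grey into red frees 3 units: for a dashed edge, for an additional
    -- red edge, and for the decrease. The values 2, 1, 0 of red, grey and blue count the steps left
    -- in the second phase, where dashed edges are free because going back also turns a node blue.
    | .grey => if first then 5 else 1
    | _ => 0
  edge _ m := match m with
    | .red => 1
    | .dashed => if first then 1 else 0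
    | _ => 0

/-- The pattern-level form of the invariants that a rule preserves. The number `d` is a lower bound
of the decrease of the potential, and `s` and `t` are the numbers of roots deleted and created. -/
structure Keeps (first : Bool) (d s t : ℕ) (r : Rule) (ι : Inst) : Prop where
  deg : ∀ i : Fin r.k,
    (degWeight first).pat r.R ι (Fin.castAdd r.j i) ≤ (degWeight first).pat r.L ι i
  deg_new : ∀ i : Fin r.j, (degWeight first).pat r.R ι (Fin.natAdd r.k i) ≤ 4
  blueIn : ∀ i : Fin r.k, blueInWeight.pat r.R ι (Fin.castAdd r.j i) ≤ blueInWeight.pat r.L ι i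
  blueIn_new : ∀ i : Fin r.j, blueInWeight.pat r.R ι (Fin.natAdd r.k i) ≤ 1
  blueOut : ∀ i : Fin r.k,
    blueOutWeight.pat r.L ι i ≤ blueOutWeight.pat r.R ι (Fin.castAdd r.j i)
  blueOut_new : ∀ i : Fin r.j, 1 ≤ blueOutWeight.pat r.R ι (Fin.natAdd r.k i)
  labelledBlue : labelledBlue.pat r.R ι ≤ labelledBlue.pat r.L ι
  greenRoot : greenRootCount.pat r.L ι ≤ greenRootCount.pat r.R ι
  potential : (potential first).pat r.R ι + d ≤ (potential first).pat r.L ι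
  -- The graph grows by no more than the potential drops, so their sum never increases.
  size : sizeWeight.pat r.R ι ≤ sizeWeight.pat r.L ι + d
  root : rootCount.pat r.R ι + s = rootCount.pat r.L ι + t

-- The rules that change the graph keep the invariants

section

set_option linter.unusedSimpArgs false

/-- This check and those below are finite: list variables and wildcard marks contribute equally on
both sides, and a bidirectional edge only requires two cases for its direction. Rules called only in
conditions of `if` are not needed here, since their effect is discarded. -/
theorem keeps_init (ι : Inst) : Keeps true 2 0 2 init ι := by
  unfold init
  constructor <;>
  simp [-Finset.sum_boole, Fin.forall_fin_succ, Fin.sum_univ_succ, Weight.pat, TotalWeight.pat,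
    Pattern.instEdges, EdgePat.inst, NodePat.inst, MarkPat.inst, LabelPat.inst, nd, rt, anyNd,
    arrow, link, x, y, z, a, b, nil, zero, Weight.edge, degWeight, blueInWeight, blueOutWeight,
    labelledBlue, greenRootCount, potential, sizeWeight, rootCount]

theorem keeps_forward1 (ι : Inst) : Keeps true 1 0 0 forward1 ι := by
  unfold forward1
  rcases h : ι.reversed 0 <;> constructor <;>
  simp [-Finset.sum_boole, Fin.forall_fin_succ, Fin.sum_univ_succ, Weight.pat, TotalWeight.pat,
    Pattern.instEdges, EdgePat.inst, NodePat.inst, MarkPat.inst, LabelPat.inst, nd, rt, anyNd,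
    arrow, link, x, y, z, a, b, nil, zero, Weight.edge, degWeight, blueInWeight, blueOutWeight,
    labelledBlue, greenRootCount, potential, sizeWeight, rootCount, h]

theorem keeps_forward2 (ι : Inst) : Keeps true 1 0 0 forward2 ι := by
  unfold forward2
  rcases h : ι.reversed 0 <;> constructor <;>
  simp [-Finset.sum_boole, Fin.forall_fin_succ, Fin.sum_univ_succ, Weight.pat, TotalWeight.pat,
    Pattern.instEdges, EdgePat.inst, NodePat.inst, MarkPat.inst, LabelPat.inst, nd, rt, anyNd,
    arrow, link, x, y, z, a, b, nil, zero, Weight.edge, degWeight, blueInWeight, blueOutWeight,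
    labelledBlue, greenRootCount, potential, sizeWeight, rootCount, h]

theorem keeps_back (ι : Inst) : Keeps true 1 0 0 back ι := by
  unfold back
  rcases h : ι.reversed 0 <;> constructor <;>
  simp [-Finset.sum_boole, Fin.forall_fin_succ, Fin.sum_univ_succ, Weight.pat, TotalWeight.pat,
    Pattern.instEdges, EdgePat.inst, NodePat.inst, MarkPat.inst, LabelPat.inst, nd, rt, anyNd,
    arrow, link, x, y, z, a, b, nil, zero, Weight.edge, degWeight, blueInWeight, blueOutWeight,
    labelledBlue, greenRootCount, potential, sizeWeight, rootCount, h]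

theorem keeps_unroot (ι : Inst) : Keeps false 0 1 0 unroot ι := by
  unfold unroot
  constructor <;>
  simp [-Finset.sum_boole, Fin.forall_fin_succ, Fin.sum_univ_succ, Weight.pat, TotalWeight.pat,
    Pattern.instEdges, EdgePat.inst, NodePat.inst, MarkPat.inst, LabelPat.inst, nd, rt, anyNd,
    arrow, link, x, y, z, a, b, nil, zero, Weight.edge, degWeight, blueInWeight, blueOutWeight,
    labelledBlue, greenRootCount, potential, sizeWeight, rootCount]

theorem keeps_skip1 (ι : Inst) : Keeps false 1 0 0 skip1 ι := by
  unfold skip1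
  constructor <;>
  simp [-Finset.sum_boole, Fin.forall_fin_succ, Fin.sum_univ_succ, Weight.pat, TotalWeight.pat,
    Pattern.instEdges, EdgePat.inst, NodePat.inst, MarkPat.inst, LabelPat.inst, nd, rt, anyNd,
    arrow, link, x, y, z, a, b, nil, zero, Weight.edge, degWeight, blueInWeight, blueOutWeight,
    labelledBlue, greenRootCount, potential, sizeWeight, rootCount]

theorem keeps_skip2 (ι : Inst) : Keeps false 1 0 0 skip2 ι := by
  unfold skip2
  constructor <;>
  simp [-Finset.sum_boole, Fin.forall_fin_succ, Fin.sum_univ_succ, Weight.pat, TotalWeight.pat,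
    Pattern.instEdges, EdgePat.inst, NodePat.inst, MarkPat.inst, LabelPat.inst, nd, rt, anyNd,
    arrow, link, x, y, z, a, b, nil, zero, Weight.edge, degWeight, blueInWeight, blueOutWeight,
    labelledBlue, greenRootCount, potential, sizeWeight, rootCount]

theorem keeps_init1 (ι : Inst) : Keeps false 1 0 1 init1 ι := by
  unfold init1
  constructor <;>
  simp [-Finset.sum_boole, Fin.forall_fin_succ, Fin.sum_univ_succ, Weight.pat, TotalWeight.pat,
    Pattern.instEdges, EdgePat.inst, NodePat.inst, MarkPat.inst, LabelPat.inst, nd, rt, anyNd,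
    arrow, link, x, y, z, a, b, nil, zero, Weight.edge, degWeight, blueInWeight, blueOutWeight,
    labelledBlue, greenRootCount, potential, sizeWeight, rootCount]

theorem keeps_init2 (ι : Inst) : Keeps false 1 0 1 init2 ι := by
  unfold init2
  constructor <;>
  simp [-Finset.sum_boole, Fin.forall_fin_succ, Fin.sum_univ_succ, Weight.pat, TotalWeight.pat,
    Pattern.instEdges, EdgePat.inst, NodePat.inst, MarkPat.inst, LabelPat.inst, nd, rt, anyNd,
    arrow, link, x, y, z, a, b, nil, zero, Weight.edge, degWeight, blueInWeight, blueOutWeight,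
    labelledBlue, greenRootCount, potential, sizeWeight, rootCount]

theorem keeps_forward (ι : Inst) : Keeps false 1 0 0 forward ι := by
  unfold forward
  constructor <;>
  simp [-Finset.sum_boole, Fin.forall_fin_succ, Fin.sum_univ_succ, Weight.pat, TotalWeight.pat,
    Pattern.instEdges, EdgePat.inst, NodePat.inst, MarkPat.inst, LabelPat.inst, nd, rt, anyNd,
    arrow, link, x, y, z, a, b, nil, zero, Weight.edge, degWeight, blueInWeight, blueOutWeight,
    labelledBlue, greenRootCount, potential, sizeWeight, rootCount]

theorem keeps_set_flag (ι : Inst) : Keeps false 1 0 0 set_flag ι := by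
  unfold set_flag
  constructor <;>
  simp [-Finset.sum_boole, Fin.forall_fin_succ, Fin.sum_univ_succ, Weight.pat, TotalWeight.pat,
    Pattern.instEdges, EdgePat.inst, NodePat.inst, MarkPat.inst, LabelPat.inst, nd, rt, anyNd,
    arrow, link, x, y, z, a, b, nil, zero, Weight.edge, degWeight, blueInWeight, blueOutWeight,
    labelledBlue, greenRootCount, potential, sizeWeight, rootCount]

theorem keeps_grey_first_push (ι : Inst) : Keeps false 1 1 0 grey_first_push ι := by
  unfold grey_first_push
  constructor <;>
  simp [-Finset.sum_boole, Fin.forall_fin_succ, Fin.sum_univ_succ, Weight.pat, TotalWeight.pat,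
    Pattern.instEdges, EdgePat.inst, NodePat.inst, MarkPat.inst, LabelPat.inst, nd, rt, anyNd,
    arrow, link, x, y, z, a, b, nil, zero, Weight.edge, degWeight, blueInWeight, blueOutWeight,
    labelledBlue, greenRootCount, potential, sizeWeight, rootCount]

theorem keeps_grey_push (ι : Inst) : Keeps false 1 1 0 grey_push ι := by
  unfold grey_push
  constructor <;>
  simp [-Finset.sum_boole, Fin.forall_fin_succ, Fin.sum_univ_succ, Weight.pat, TotalWeight.pat,
    Pattern.instEdges, EdgePat.inst, NodePat.inst, MarkPat.inst, LabelPat.inst, nd, rt, anyNd,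
    arrow, link, x, y, z, a, b, nil, zero, Weight.edge, degWeight, blueInWeight, blueOutWeight,
    labelledBlue, greenRootCount, potential, sizeWeight, rootCount]

theorem keeps_back_first_push (ι : Inst) : Keeps false 1 0 0 back_first_push ι := by
  unfold back_first_push
  constructor <;>
  simp [-Finset.sum_boole, Fin.forall_fin_succ, Fin.sum_univ_succ, Weight.pat, TotalWeight.pat,
    Pattern.instEdges, EdgePat.inst, NodePat.inst, MarkPat.inst, LabelPat.inst, nd, rt, anyNd,
    arrow, link, x, y, z, a, b, nil, zero, Weight.edge, degWeight, blueInWeight, blueOutWeight,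
    labelledBlue, greenRootCount, potential, sizeWeight, rootCount]

theorem keeps_back_push (ι : Inst) : Keeps false 1 0 0 back_push ι := by
  unfold back_push
  constructor <;>
  simp [-Finset.sum_boole, Fin.forall_fin_succ, Fin.sum_univ_succ, Weight.pat, TotalWeight.pat,
    Pattern.instEdges, EdgePat.inst, NodePat.inst, MarkPat.inst, LabelPat.inst, nd, rt, anyNd,
    arrow, link, x, y, z, a, b, nil, zero, Weight.edge, degWeight, blueInWeight, blueOutWeight,
    labelledBlue, greenRootCount, potential, sizeWeight, rootCount]

end

-- All rules except `init` have short, local search plans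

theorem isFast_flag : flag.IsFast := ⟨rfl, by decide, by decide⟩

theorem isFast_forward1 : forward1.IsFast := ⟨rfl, by decide, by decide⟩

theorem isFast_forward2 : forward2.IsFast := ⟨rfl, by decide, by decide⟩

theorem isFast_back : back.IsFast := ⟨rfl, by decide, by decide⟩

theorem isFast_unroot : unroot.IsFast := ⟨rfl, by decide, by decide⟩

theorem isFast_skip1 : skip1.IsFast := ⟨rfl, by decide, by decide⟩

theorem isFast_skip2 : skip2.IsFast := ⟨rfl, by decide, by decide⟩

theorem isFast_init1 : init1.IsFast := ⟨rfl, by decide, by decide⟩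

theorem isFast_init2 : init2.IsFast := ⟨rfl, by decide, by decide⟩

theorem isFast_forward : forward.IsFast := ⟨rfl, by decide, by decide⟩

theorem isFast_loop : loop.IsFast := ⟨rfl, by decide, by decide⟩

theorem isFast_set_flag : set_flag.IsFast := ⟨rfl, by decide, by decide⟩

theorem isFast_two_cycle : two_cycle.IsFast := ⟨rfl, by decide, by decide⟩

theorem isFast_back_edge : back_edge.IsFast := ⟨rfl, by decide, by decide⟩

theorem isFast_grey_first_push : grey_first_push.IsFast := ⟨rfl, by decide, by decide⟩

theorem isFast_grey_push : grey_push.IsFast := ⟨rfl, by decide, by decide⟩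

theorem isFast_back_first_push : back_first_push.IsFast := ⟨rfl, by decide, by decide⟩

theorem isFast_back_push : back_push.IsFast := ⟨rfl, by decide, by decide⟩

end GP2.TopSort

namespace GP2.TopSort

/-! # Invariants of `top-sort` -/

/-- The invariants that do not concern the roots. -/
structure Core (first : Bool) (D S : ℕ) (G : HostGraph) : Prop where
  deg : ∀ v ∈ G.nodes, (degWeight first).loc G v ≤ D + 4
  blueIn : ∀ v ∈ G.nodes, blueInWeight.loc G v ≤ 1
  blueOut : ∀ v ∈ G.nodes, 1 ≤ blueOutWeight.loc G v
  labelledBlue : labelledBlue.tot G = 0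
  size : G.size + (potential first).tot G ≤ S

/-- The invariants that hold throughout the program after `init`. -/
structure Inv (first : Bool) (D S : ℕ) (G : HostGraph) : Prop extends Core first D S G where
  greenRoot : 1 ≤ greenRootCount.tot G

theorem tot_sizeWeight (G : HostGraph) : sizeWeight.tot G = G.size := by
  simp [TotalWeight.tot, sizeWeight, HostGraph.size]

theorem tot_rootCount (G : HostGraph) : rootCount.tot G = G.roots.card := by
  simp [TotalWeight.tot, rootCount, HostGraph.roots]

section

variable {first : Bool} {D S d s t : ℕ} {r : Rule} {G H : HostGraph}

theorem Core.applies (hr : ∀ ι, Keeps first d s t r ι) (h : r.Applies G H)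
    (hG : Core first D S G) : Core first D S H := by
  obtain ⟨ι, g, h⟩ := h
  have k := hr ι
  refine ⟨h.loc_le _ k.deg (fun i => (k.deg_new i).trans (by omega)) hG.deg,
    h.loc_le _ k.blueIn k.blueIn_new hG.blueIn, h.le_loc _ k.blueOut k.blueOut_new hG.blueOut,
    ?_, ?_⟩
  · have h1 := h.tot TopSort.labelledBlue
    have h2 := k.labelledBlue
    have h3 := hG.labelledBlue
    omega
  · have h1 := h.tot sizeWeight
    have h2 := h.tot (potential first)
    have h3 := k.size
    have h4 := k.potential
    have h5 := hG.size
    rw [tot_sizeWeight, tot_sizeWeight] at h1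
    omega

theorem Inv.applies (hr : ∀ ι, Keeps first d s t r ι) (h : r.Applies G H)
    (hG : Inv first D S G) : Inv first D S H := by
  refine ⟨hG.toCore.applies hr h, ?_⟩
  obtain ⟨ι, g, h⟩ := h
  have h1 := h.tot greenRootCount
  have h2 := (hr ι).greenRoot
  have h3 := hG.greenRoot
  omega

theorem card_roots_of_applies (hr : ∀ ι, Keeps first d s t r ι) (h : r.Applies G H) :
    H.roots.card + s = G.roots.card + t := by
  obtain ⟨ι, g, h⟩ := h
  have h1 := h.tot rootCount
  have h2 := (hr ι).root
  rw [tot_rootCount, tot_rootCount] at h1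
  omega

theorem potential_of_applies (hr : ∀ ι, Keeps first d s t r ι) (h : r.Applies G H) :
    (potential first).tot H + d ≤ (potential first).tot G := by
  obtain ⟨ι, g, h⟩ := h
  have h1 := h.tot (potential first)
  have h2 := (hr ι).potential
  omega

theorem potential_false_le (G : HostGraph) :
    (potential false).tot G ≤ (potential true).tot G := by
  refine add_le_add (Finset.sum_le_sum fun v _ => ?_) (Multiset.sum_map_le_sum_map _ _ fun e _ => ?_)
  · cases h : (G.attr v).mark <;> simp [potential, h]
  · cases h : e.mark <;> simp [potential]

/-- Reserves and potential of the second phase are pointwise at most those of the first, so changing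
phase is free. -/
theorem Inv.second (hG : Inv true D S G) : Inv false D S G where
  deg v hv := by
    refine le_trans (add_le_add_left ?_ _) (hG.deg v hv)
    cases h : (G.attr v).mark <;> simp [degWeight, h]
  blueIn := hG.blueIn
  blueOut := hG.blueOut
  labelledBlue := hG.labelledBlue
  size := by
    have h1 := hG.size
    have h2 := potential_false_le G
    omega
  greenRoot := hG.greenRoot

theorem degree_eq_sum (G : HostGraph) (v : ℕ) :
    (G.edges.map ((degWeight first).edge v)).sum = G.degree v := by
  unfold HostGraph.degree HostGraph.outEdges HostGraph.inEdges Weight.edge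
  rw [Multiset.sum_map_add, ← Multiset.countP_eq_card_filter, ← Multiset.countP_eq_card_filter]
  simp only [degWeight]
  congr 1 <;>
  · induction G.edges using Multiset.induction_on with
    | empty => simp
    | cons e E ih => rw [Multiset.countP_cons, ← ih, Multiset.map_cons, Multiset.sum_cons, add_comm]

theorem degree_le_loc (G : HostGraph) (v : ℕ) : G.degree v ≤ (degWeight first).loc G v :=
  (degree_eq_sum G v).symm.trans_le (Nat.le_add_left _ _)

theorem Core.bounded (hG : Core first D S G) (h : G.roots.card ≤ 2) : G.Bounded (D + 4) where
  roots := by omega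
  degree v := by
    by_cases hv : v ∈ G.nodes
    · exact (degree_le_loc G v).trans (hG.deg v hv)
    · have : G.degree v = 0 := by
        simp only [HostGraph.degree, HostGraph.outEdges, HostGraph.inEdges, add_eq_zero,
          Multiset.card_eq_zero, Multiset.filter_eq_nil]
        exact ⟨fun e he h' => hv (h' ▸ (G.incident e he).1),
          fun e he h' => hv (h' ▸ (G.incident e he).2)⟩
      omega

end

-- Marks of roots, and rules that are certain to be applicable

/-- The graph has a root with the given mark. -/
def HasRoot (G : HostGraph) (m : NodeMark) : Prop :=
  ∃ v ∈ G.nodes, (G.attr v).root = true ∧ (G.attr v).mark = m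

theorem hasRoot_of_appliesVia {r : Rule} {G H : HostGraph} {ι : Inst} {g : Fin (r.k + r.j) → ℕ}
    (h : r.AppliesVia G H ι g) (i : Fin (r.k + r.j)) {m : NodeMark}
    (hi : (r.R.node i).root = true) (hm : (r.R.node i).mark = .fixed m) : HasRoot H m := by
  refine ⟨g i, ?_, ?_, ?_⟩
  · rw [h.nodes]
    exact Finset.mem_union_right _ (Finset.mem_image_of_mem _ (Finset.mem_univ _))
  · rw [h.attr]
    exact hi
  · rw [h.attr]
    simp [NodePat.inst, hm, MarkPat.inst]

theorem hasRoot_init1 {G H : HostGraph} (h : init1.Applies G H) : HasRoot H .grey := by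
  obtain ⟨ι, g, h⟩ := h
  exact hasRoot_of_appliesVia h (0 : Fin 3) rfl rfl

theorem hasRoot_init2 {G H : HostGraph} (h : init2.Applies G H) : HasRoot H .grey := by
  obtain ⟨ι, g, h⟩ := h
  exact hasRoot_of_appliesVia h (0 : Fin 2) rfl rfl

theorem hasRoot_forward {G H : HostGraph} (h : forward.Applies G H) : HasRoot H .grey := by
  obtain ⟨ι, g, h⟩ := h
  exact hasRoot_of_appliesVia h (1 : Fin 2) rfl rfl

theorem hasRoot_back_first_push {G H : HostGraph} (h : back_first_push.Applies G H) :
    HasRoot H .grey := by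
  obtain ⟨ι, g, h⟩ := h
  exact hasRoot_of_appliesVia h (0 : Fin 3) rfl rfl

theorem hasRoot_back_push {G H : HostGraph} (h : back_push.Applies G H) : HasRoot H .grey := by
  obtain ⟨ι, g, h⟩ := h
  exact hasRoot_of_appliesVia h (0 : Fin 4) rfl rfl

theorem hasRoot_set_flag {G H : HostGraph} (h : set_flag.Applies G H) : HasRoot H .none := by
  obtain ⟨ι, g, h⟩ := h
  exact hasRoot_of_appliesVia h (0 : Fin 1) rfl rfl

/-- The instantiation that assigns the given labels to the variables `x` and `y`. -/
def instLabels (l l' : Label) : Inst where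
  val n := if n = 0 then l else l'
  wild _ := .red
  reversed _ := false
  wild_marked _ := nofun

theorem attr_eq {a : NodeAttr} {l : Label} {m : NodeMark} {b : Bool} (hl : a.label = l)
    (hm : a.mark = m) (hb : a.root = b) : a = ⟨l, m, b⟩ := by
  cases a; simp_all

theorem exists_applies_flag {G : HostGraph} (h : HasRoot G .none) : ∃ H, flag.Applies G H := by
  obtain ⟨v, hv, hr, hm⟩ := h
  refine Pattern.IsMatch.exists_applies (r := flag) rfl (ι := instLabels (G.attr v).label [])
    (g := fun _ => v) ⟨fun (i j : Fin 1) _ => Subsingleton.elim i j, fun _ => hv, ?_, ?_⟩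
  · intro (i : Fin 1)
    rw [Subsingleton.elim i 0]
    exact attr_eq rfl hm hr
  · exact Multiset.zero_le _

theorem exists_applies_set_flag {G : HostGraph} (h : HasRoot G .grey) :
    ∃ H, set_flag.Applies G H := by
  obtain ⟨v, hv, hr, hm⟩ := h
  refine Pattern.IsMatch.exists_applies (r := set_flag) rfl
    (ι := instLabels (G.attr v).label []) (g := fun _ => v)
    ⟨fun (i j : Fin 1) _ => Subsingleton.elim i j, fun _ => hv, ?_, ?_⟩
  · intro (i : Fin 1)
    rw [Subsingleton.elim i 0]
    exact attr_eq rfl hm hr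
  · exact Multiset.zero_le _

theorem exists_applies_grey_first_push {G : HostGraph} (h : HasRoot G .grey) {u : ℕ}
    (hu : u ∈ G.nodes) (hu' : G.attr u = ⟨[], .green, true⟩) :
    ∃ H, grey_first_push.Applies G H := by
  obtain ⟨v, hv, hr, hm⟩ := h
  have huv : u ≠ v := by rintro rfl; simp [hu'] at hm
  have hinj : Function.Injective (![u, v] : Fin 2 → ℕ) := by
    intro i j
    fin_cases i <;> fin_cases j <;> simp [huv, huv.symm]
  refine Pattern.IsMatch.exists_applies (r := grey_first_push) rfl
    (ι := instLabels (G.attr v).label []) (g := (![u, v] : Fin 2 → ℕ)) ⟨hinj, ?_, ?_, ?_⟩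
  · intro (i : Fin 2)
    fin_cases i
    · exact hu
    · exact hv
  · intro (i : Fin 2)
    fin_cases i
    · exact hu'
    · exact attr_eq rfl hm hr
  · exact Multiset.zero_le _

theorem exists_applies_grey_push {G : HostGraph} (h : HasRoot G .grey) {u w : ℕ}
    (hu : u ∈ G.nodes) (hu' : G.attr u = ⟨[Sum.inl 0], .green, true⟩) (hw : w ∈ G.nodes)
    (hwm : (G.attr w).mark = .blue) (hwr : (G.attr w).root = false)
    (he : ⟨u, w, [], .blue⟩ ∈ G.edges) : ∃ H, grey_push.Applies G H := by
  obtain ⟨v, hv, hr, hm⟩ := h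
  have huv : u ≠ v := by rintro rfl; simp [hu'] at hm
  have huw : u ≠ w := by rintro rfl; simp [hu'] at hwm
  have hvw : v ≠ w := by rintro rfl; simp [hwr] at hr
  have hinj : Function.Injective (![v, w, u] : Fin 3 → ℕ) := by
    intro i j
    fin_cases i <;> fin_cases j <;> simp [huv, huv.symm, huw, huw.symm, hvw, hvw.symm]
  refine Pattern.IsMatch.exists_applies (r := grey_push) rfl
    (ι := instLabels (G.attr v).label (G.attr w).label) (g := (![v, w, u] : Fin 3 → ℕ))
    ⟨hinj, ?_, ?_, ?_⟩
  · intro (i : Fin 3)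
    fin_cases i
    · exact hv
    · exact hw
    · exact hu
  · intro (i : Fin 3)
    fin_cases i
    · exact attr_eq rfl hm hr
    · exact attr_eq rfl hwm hwr
    · exact hu'
  · exact Multiset.singleton_le.2 he

/-- Some green root is labelled with the empty list or 0. In the first case `grey_first_push`
matches. In the second, `blueOut` yields a blue edge leaving it; its label is empty by
`labelledBlue`. Its target is blue, because a node that is not blue already exhausts the bound of
`blueIn`, and unrooted, because the green and the grey root are already two. Hence `grey_push`
matches. -/
theorem Inv.exists_push {first : Bool} {D S : ℕ} {G : HostGraph} (hG : Inv first D S G)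
    (h2 : G.roots.card ≤ 2) (h : HasRoot G .grey) :
    (∃ H, grey_push.Applies G H) ∨ ∃ H, grey_first_push.Applies G H := by
  obtain ⟨u, hu, hu'⟩ : ∃ u ∈ G.nodes, greenRootCount.node (G.attr u) ≠ 0 := by
    by_contra! hc
    have := hG.greenRoot
    simp [TotalWeight.tot, greenRootCount] at this
    obtain ⟨u, hu⟩ := this
    simp only [Finset.mem_filter] at hu
    have := hc u hu.1
    simp [greenRootCount] at this
    tauto
  simp only [greenRootCount, ne_eq, ite_eq_right_iff, one_ne_zero, imp_false, not_not] at hu'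
  obtain ⟨hur, hum, hul | hul⟩ := hu'
  · exact .inr (exists_applies_grey_first_push h hu (attr_eq hul hum hur))
  · left
    obtain ⟨e, he, hsrc, hmark⟩ : ∃ e ∈ G.edges, e.src = u ∧ e.mark = .blue := by
      by_contra! hc
      have h1 := hG.blueOut u hu
      have h3 : (G.edges.map (blueOutWeight.edge u)).sum = 0 := by
        refine Multiset.sum_eq_zero fun n hn => ?_
        obtain ⟨e, he, rfl⟩ := Multiset.mem_map.1 hn
        by_cases hs : e.src = u
        · simp [Weight.edge, blueOutWeight, hc e he hs]
        · simp [Weight.edge, blueOutWeight, hs]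
      simp [Weight.loc, h3] at h1
      simp [blueOutWeight, hum, hul] at h1
    have hw := (G.incident e he).2
    have hlab : e.label = [] := by
      by_contra hl
      have h1 := hG.labelledBlue
      have h3 : (1 : ℕ) ≤ (G.edges.map fun e => labelledBlue.edge e.label e.mark).sum :=
        Multiset.single_le_sum (fun _ _ => Nat.zero_le _) _
          (Multiset.mem_map.2 ⟨e, he, by simp [labelledBlue, hmark, hl]⟩)
      unfold TotalWeight.tot at h1
      omega
    have hwm : (G.attr e.tgt).mark = .blue := by
      by_contra hm
      have h1 := hG.blueIn _ hw
      have h3 : (1 : ℕ) ≤ (G.edges.map (blueInWeight.edge e.tgt)).sum :=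
        Multiset.single_le_sum (fun _ _ => Nat.zero_le _) _
          (Multiset.mem_map.2 ⟨e, he, by simp [Weight.edge, blueInWeight, hmark]⟩)
      have h4 : blueInWeight.node (G.attr e.tgt) = 1 := by simp [blueInWeight, hm]
      unfold Weight.loc at h1
      omega
    have hwr : (G.attr e.tgt).root = false := by
      by_contra hr
      obtain ⟨v, hv, hvr, hvm⟩ := h
      have h1 : ({u, v, e.tgt} : Finset ℕ) ⊆ G.roots := by
        intro n hn
        simp only [Finset.mem_insert, Finset.mem_singleton] at hn
        obtain rfl | rfl | rfl := hn <;> simp_all [HostGraph.roots]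
      have h3 := Finset.card_le_card h1
      rw [Finset.card_eq_three.2 ⟨u, v, e.tgt, ?_, ?_, ?_, rfl⟩] at h3
      · omega
      · rintro rfl; simp [hum] at hvm
      · rintro rfl; simp [hum] at hwm
      · rintro rfl; simp [hvm] at hwm
    refine exists_applies_grey_push h hu (attr_eq hul hum hur) hw hwm hwr ?_
    obtain ⟨s, t, l, m⟩ := e
    simp only at hsrc hmark hlab
    subst hsrc hmark hlab
    exact he

end GP2.TopSort

namespace GP2

-- Budgets for calls of fast rules

theorem Spec.try_call {r : Rule} (hr : r.IsFast) {P Q : Com} {G : HostGraph} {M B : ℕ}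
    {R : Config → ℕ → Prop} (hG : G.Bounded M) (h : ∀ H, r.Applies G H → Spec P H B R)
    (hf : (∀ H, ¬ r.Applies G H) → Spec Q G B R) :
    Spec (.tryte (.call [r]) P Q) G (callBound M + B + 1) R := by
  refine .tryte (.call_fast (by simpa using hr) (by simp) hG ?_ ?_)
  · intro r' hr' H hH
    obtain rfl := List.mem_singleton.1 hr'
    exact h H hH
  · intro hn
    exact hf (hn r (List.mem_singleton.2 rfl))

theorem Spec.if_call {rs : List Rule} (hrs : ∀ r ∈ rs, r.IsFast) (hl : rs.length ≤ 3) {P Q : Com}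
    {G : HostGraph} {M B : ℕ} {R : Config → ℕ → Prop} (hG : G.Bounded M) (h : Spec P G B R)
    (hf : (∀ r ∈ rs, ∀ H, ¬ r.Applies G H) → Spec Q G B R) :
    Spec (.ifte (.call rs) P Q) G (callBound M + B + 1) R :=
  .ifte (.call_fast hrs hl hG (fun _ _ _ _ => h) hf)

theorem Spec.call_one {r : Rule} (hr : r.IsFast) {G : HostGraph} {M B : ℕ}
    {R : Config → ℕ → Prop} (hG : G.Bounded M) (h : ∀ H, r.Applies G H → R (.done H) B)
    (hf : (∀ H, ¬ r.Applies G H) → R .failed B) :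
    Spec (.call [r]) G (callBound M + B) R := by
  refine .call_fast (by simpa using hr) (by simp) hG ?_ ?_
  · intro r' hr' H hH
    obtain rfl := List.mem_singleton.1 hr'
    exact h H hH
  · intro hn
    exact hf (hn r (List.mem_singleton.2 rfl))

/-- A loop whose body calls rules that decrease a potential `φ`. -/
theorem Spec.loop_call {rs : List Rule} (hrs : ∀ r ∈ rs, r.IsFast) (hl : rs.length ≤ 3)
    {J : HostGraph → Prop} {φ : HostGraph → ℕ} {M c e : ℕ} {R : Config → ℕ → Prop}
    (hJ : ∀ G, J G → G.Bounded M)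
    (hstep : ∀ r ∈ rs, ∀ G H, J G → r.Applies G H → J H ∧ φ H + 1 ≤ φ G)
    (hc : callBound M + 1 ≤ c) (hR : ∀ H, J H → R (.done H) (c * φ H + e))
    {G : HostGraph} (hG : J G) :
    Spec (.loop (.call rs)) G (c * φ G + e + callBound M + 1) R := by
  refine .loop (fun H b => J H ∧ c * φ H + e + callBound M + 1 ≤ b) ?_ ⟨hG, le_rfl⟩
  rintro H b ⟨hH, hb⟩
  refine ⟨callBound M + (c * φ H + e), by omega, .call_fast hrs hl (hJ H hH) ?_ ?_⟩
  · intro r hr H' hH'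
    obtain ⟨h1, h2⟩ := hstep r hr H H' hH hH'
    have h3 := Nat.mul_le_mul_left c h2
    rw [mul_add, mul_one] at h3
    exact ⟨h1, by omega⟩
  · intro _
    exact hR H hH

namespace TopSort

-- The loops of the program and their invariants

variable {D S c : ℕ}

/-- The invariant of `StackNodes!`. -/
def StackInv (D S : ℕ) (G : HostGraph) : Prop := Inv true D S G ∧ G.roots.card = 2

/-- The invariant of `SortNodes!`. -/
def SortInv (D S : ℕ) (G : HostGraph) : Prop :=
  Inv false D S G ∧ G.roots.card = 2 ∧ HasRoot G .grey

/-- The invariant of `LoopNodes!`. -/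
def LoopInv (D S : ℕ) (G : HostGraph) : Prop :=
  Inv false D S G ∧ (G.roots.card = 1 ∨ G.roots.card = 2 ∧ HasRoot G .none)

theorem StackInv.bounded {G : HostGraph} (h : StackInv D S G) : G.Bounded (D + 4) :=
  h.1.bounded h.2.le

theorem SortInv.bounded {G : HostGraph} (h : SortInv D S G) : G.Bounded (D + 4) :=
  h.1.bounded h.2.1.le

theorem LoopInv.bounded {G : HostGraph} (h : LoopInv D S G) : G.Bounded (D + 4) :=
  h.1.bounded (by have := h.2; omega)

theorem StackInv.applies {d : ℕ} {r : Rule} (hr : ∀ ι, Keeps true d 0 0 r ι) {G H : HostGraph}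
    (hG : StackInv D S G) (h : r.Applies G H) :
    StackInv D S H ∧ (potential true).tot H + d ≤ (potential true).tot G := by
  have h1 := card_roots_of_applies hr h
  exact ⟨⟨hG.1.applies hr h, by have := hG.2; omega⟩, potential_of_applies hr h⟩

theorem SortInv.applies {d : ℕ} {r : Rule} (hr : ∀ ι, Keeps false d 0 0 r ι) {G H : HostGraph}
    (hG : SortInv D S G) (h : r.Applies G H) (hH : HasRoot H .grey) :
    SortInv D S H ∧ (potential false).tot H + d ≤ (potential false).tot G := by
  have h1 := card_roots_of_applies hr h
  exact ⟨⟨hG.1.applies hr h, by have := hG.2.1; omega, hH⟩, potential_of_applies hr h⟩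

theorem mul_le_of_decrease {φ φ' : ℕ} (h : φ' + 1 ≤ φ) : c * φ' + c ≤ c * φ := by
  simpa [mul_add] using Nat.mul_le_mul_left c h

/-- The budget consists of the credit `c` per unit of potential, the amount `e` handed on, and a
reserve for the calls of one round that change nothing. Each forward step is paid by its own credit.
A successful `back` frees `c`, which renews the reserve; otherwise the loop breaks. -/
theorem spec_stackNodes (hc : 10 * callBound (D + 4) ≤ c) {e : ℕ} {R : Config → ℕ → Prop}
    (hR : ∀ H b, StackInv D S H → c * (potential true).tot H + e ≤ b → R (.done H) b)
    {G : HostGraph} (hG : StackInv D S G) {B : ℕ}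
    (hB : c * (potential true).tot G + e + 5 * callBound (D + 4) ≤ B) :
    Spec (.loop StackNodes) G B R := by
  have hK : 14 ≤ callBound (D + 4) := Nat.le_add_left _ _
  refine .loop (fun H b => StackInv D S H ∧
    c * (potential true).tot H + e + 5 * callBound (D + 4) ≤ b) ?_ ⟨hG, hB⟩
  rintro H b ⟨hH, hb⟩
  refine ⟨b - 1, by omega, .seq ((Spec.loop_call (J := StackInv D S)
    (φ := (potential true).tot) (M := D + 4) (c := c) (e := e + 2 * callBound (D + 4))
    ?_ (by simp) (fun _ => StackInv.bounded) ?_ (by omega) ?_ hH).mono_budget (by omega))⟩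
  · simpa using ⟨isFast_forward1, isFast_forward2⟩
  · simp only [List.mem_cons, List.not_mem_nil, or_false]
    rintro r (rfl | rfl) G H hG h
    · exact hG.applies keeps_forward1 h
    · exact hG.applies keeps_forward2 h
  · intro H' hH'
    refine (Spec.try_call (B := c * (potential true).tot H' + e + 1) isFast_back hH'.bounded
      ?_ ?_).mono_budget (by omega)
    · intro H'' h
      obtain ⟨h1, h2⟩ := hH'.applies keeps_back h
      have h3 := mul_le_of_decrease (c := c) h2
      exact .skip ⟨h1, by omega⟩
    · intro _
      exact .brk (hR _ _ hH' (by omega))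

/-- The body cannot fail: `set_flag` matches the grey root, and `Inv.exists_push` supplies the last
push. So the loop ends only by `break`, with the second root either unmarked or gone, which is what
`LoopInv` allows. In all other rounds going back lowers the potential and moves the grey root. -/
theorem spec_sortNodes (hc : 10 * callBound (D + 4) ≤ c) {e : ℕ} {R : Config → ℕ → Prop}
    (hR : ∀ H b, LoopInv D S H → c * (potential false).tot H + e ≤ b → R (.done H) b)
    {G : HostGraph} (hG : SortInv D S G) {B : ℕ}
    (hB : c * (potential false).tot G + e + 10 * callBound (D + 4) ≤ B) :
    Spec (.loop SortNodes) G B R := by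
  have hK : 14 ≤ callBound (D + 4) := Nat.le_add_left _ _
  refine .loop (fun H b => SortInv D S H ∧
    c * (potential false).tot H + e + 10 * callBound (D + 4) ≤ b) ?_ ⟨hG, hB⟩
  rintro H b ⟨hH, hb⟩
  refine ⟨b - 1, by omega, .seq ((Spec.loop_call (J := SortInv D S)
    (φ := (potential false).tot) (M := D + 4) (c := c) (e := e + 8 * callBound (D + 4))
    (by simpa using isFast_forward) (by simp) (fun _ => SortInv.bounded) ?_ (by omega) ?_
    hH).mono_budget (by omega))⟩
  · intro r hr G H hG h
    obtain rfl := List.mem_singleton.1 hr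
    exact hG.applies keeps_forward h (hasRoot_forward h)
  clear! H b G
  intro H hH
  refine .seq ((Spec.if_call (B := c * (potential false).tot H + e + 6 * callBound (D + 4))
    ?_ (by simp) hH.bounded ?_ fun _ => ?_).mono_budget (by omega))
  · simpa using ⟨isFast_loop, isFast_two_cycle, isFast_back_edge⟩
  · refine .seq ((Spec.call_one (B := c * (potential false).tot H + e + 2) isFast_set_flag
      hH.bounded (fun H' h => ?_) fun h => ?_).mono_budget (by omega))
    · refine .brk ⟨_, rfl, hR _ _ ⟨hH.1.applies keeps_set_flag h, .inr ⟨?_, hasRoot_set_flag h⟩⟩ ?_⟩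
      · have h1 := card_roots_of_applies keeps_set_flag h
        have h2 := hH.2.1
        omega
      · have h1 := mul_le_of_decrease (c := c) (potential_of_applies keeps_set_flag h)
        omega
    · obtain ⟨H', h'⟩ := exists_applies_set_flag hH.2.2
      exact absurd h' (h H')
  · refine (Spec.skip (B := c * (potential false).tot H + e + 5 * callBound (D + 4))
      ?_).mono_budget (by omega)
    refine (Spec.try_call (B := c * (potential false).tot H + e + 4 * callBound (D + 4) - 1)
      isFast_back_push hH.bounded (fun H' h => ?_) fun _ => ?_).mono_budget (by omega)
    · obtain ⟨h1, h2⟩ := hH.applies keeps_back_push h (hasRoot_back_push h)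
      have h3 := mul_le_of_decrease (c := c) h2
      exact (Spec.skip ⟨h1, le_rfl⟩).mono_budget (by omega)
    refine (Spec.try_call (B := c * (potential false).tot H + e + 3 * callBound (D + 4) - 2)
      isFast_back_first_push hH.bounded (fun H' h => ?_) fun _ => ?_).mono_budget (by omega)
    · obtain ⟨h1, h2⟩ := hH.applies keeps_back_first_push h (hasRoot_back_first_push h)
      have h3 := mul_le_of_decrease (c := c) h2
      exact (Spec.skip ⟨h1, le_rfl⟩).mono_budget (by omega)
    have key : ∀ {r : Rule}, (∀ ι, Keeps false 1 1 0 r ι) → ∀ {H' : HostGraph},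
        r.Applies H H' → LoopInv D S H' ∧
          c * (potential false).tot H' + c ≤ c * (potential false).tot H := by
      intro r hr H' h
      have h1 := card_roots_of_applies hr h
      have h2 := hH.2.1
      exact ⟨⟨hH.1.applies hr h, .inl (by omega)⟩, mul_le_of_decrease (potential_of_applies hr h)⟩
    refine .seq ((Spec.try_call (B := c * (potential false).tot H + e + callBound (D + 4))
      isFast_grey_push hH.bounded (fun H' h => ?_) fun hn => ?_).mono_budget (by omega))
    · obtain ⟨h1, h2⟩ := key keeps_grey_push h
      exact (Spec.skip (.brk (hR _ _ h1 (Nat.le_add_right _ c)))).mono_budget (by omega)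
    · refine (Spec.call_one (B := c * (potential false).tot H + e) isFast_grey_first_push
        hH.bounded (fun H' h => ?_) fun hn' => ?_).mono_budget (by omega)
      · obtain ⟨h1, h2⟩ := key keeps_grey_first_push h
        exact .brk (hR _ _ h1 (by omega))
      · obtain ⟨H', h⟩ | ⟨H', h⟩ := hH.1.exists_push hH.2.1.le hH.2.2
        · exact absurd h (hn H')
        · exact absurd h (hn' H')

/-- An unmarked root makes `flag` applicable and ends the loop. Past that test the number of roots
is therefore one, and `init1` or `init2` raises it to no more than two. -/
theorem spec_loopNodes (hc : 50 * callBound (D + 4) ≤ c) {e : ℕ} {R : Config → ℕ → Prop}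
    (hR : ∀ H b, LoopInv D S H → c * (potential false).tot H + e ≤ b → R (.done H) b)
    {G : HostGraph} (hG : LoopInv D S G) {B : ℕ}
    (hB : c * (potential false).tot G + e + 10 * callBound (D + 4) ≤ B) :
    Spec (.loop LoopNodes) G B R := by
  have hK : 14 ≤ callBound (D + 4) := Nat.le_add_left _ _
  refine .loop (fun H b => LoopInv D S H ∧
    c * (potential false).tot H + e + 10 * callBound (D + 4) ≤ b) ?_ ⟨hG, hB⟩
  clear! G
  rintro H b ⟨hH, hb⟩
  refine ⟨b - 1, by omega, .seq ((Spec.if_call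
    (B := c * (potential false).tot H + e + 8 * callBound (D + 4))
    (by simpa using isFast_flag) (by simp) hH.bounded ?_ fun hn => ?_).mono_budget (by omega))⟩
  · exact .brk ⟨_, (Nat.sub_add_cancel (by omega)).symm, hR _ _ hH (by omega)⟩
  have h1 : H.roots.card = 1 := by
    refine hH.2.resolve_right fun h => ?_
    obtain ⟨H', h'⟩ := exists_applies_flag h.2
    exact hn flag (List.mem_singleton.2 rfl) H' h'
  have skip_key : ∀ {r : Rule}, (∀ ι, Keeps false 1 0 0 r ι) → ∀ {H' : HostGraph},
      r.Applies H H' → LoopInv D S H' ∧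
        c * (potential false).tot H' + c ≤ c * (potential false).tot H := by
    intro r hr H' h
    have h2 := card_roots_of_applies hr h
    exact ⟨⟨hH.1.applies hr h, .inl (by omega)⟩, mul_le_of_decrease (potential_of_applies hr h)⟩
  have init_key : ∀ {r : Rule}, (∀ ι, Keeps false 1 0 1 r ι) → ∀ {H' : HostGraph},
      r.Applies H H' → HasRoot H' .grey → SortInv D S H' ∧
        c * (potential false).tot H' + c ≤ c * (potential false).tot H := by
    intro r hr H' h h'
    have h2 := card_roots_of_applies hr h
    exact ⟨⟨hH.1.applies hr h, by omega, h'⟩, mul_le_of_decrease (potential_of_applies hr h)⟩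
  refine (Spec.skip (B := c * (potential false).tot H + e + 7 * callBound (D + 4))
    ?_).mono_budget (by omega)
  refine (Spec.try_call (B := c * (potential false).tot H + e + 5 * callBound (D + 4))
    isFast_skip1 hH.bounded (fun H' h => ?_) fun _ => ?_).mono_budget (by omega)
  · obtain ⟨h1, h2⟩ := skip_key keeps_skip1 h
    exact (Spec.skip ⟨h1, le_rfl⟩).mono_budget (by omega)
  refine (Spec.try_call (B := c * (potential false).tot H + e + 4 * callBound (D + 4) - 1)
    isFast_skip2 hH.bounded (fun H' h => ?_) fun _ => ?_).mono_budget (by omega)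
  · obtain ⟨h1, h2⟩ := skip_key keeps_skip2 h
    exact (Spec.skip ⟨h1, le_rfl⟩).mono_budget (by omega)
  refine (Spec.try_call (B := c * (potential false).tot H + e + 3 * callBound (D + 4) - 2)
    isFast_init1 hH.bounded (fun H' h => ?_) fun _ => ?_).mono_budget (by omega)
  · obtain ⟨h1, h2⟩ := init_key keeps_init1 h (hasRoot_init1 h)
    -- Sorting hands on the reserve of the outer loop as part of its own `e`; the credit freed by
    -- the initial step pays for the reserve of the inner loop.
    exact spec_sortNodes (c := c) (e := e + 10 * callBound (D + 4)) (by omega)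
      (fun H'' b h h' => ⟨h, by omega⟩) h1 (by omega)
  refine (Spec.try_call (B := c * (potential false).tot H + e)
    isFast_init2 hH.bounded (fun H' h => ?_) fun _ => ?_).mono_budget (by omega)
  · obtain ⟨h1, h2⟩ := init_key keeps_init2 h (hasRoot_init2 h)
    exact spec_sortNodes (c := c) (e := e + 10 * callBound (D + 4)) (by omega)
      (fun H'' b h h' => ⟨h, by omega⟩) h1 (by omega)
  · exact .brk (hR _ _ hH le_rfl)

-- Input graphs and the whole program

/-- What `top-sort` achieves: a result of bounded size, unless it fails. -/
def MainPost (S : ℕ) : Config → ℕ → Prop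
  | .done H, _ => H.size ≤ S
  | .failed, _ => True
  | .run _ _, _ => False

/-- Grey nodes have potential 5 and unmarked edges 0. Together with the size this gives `6 *
G.size`, which bounds the size of all later graphs. -/
theorem core_of_isInput {G : HostGraph} (hG : G.IsInput) (hD : ∀ v ∈ G.nodes, G.degree v ≤ D) :
    Core true D (6 * G.size) G ∧ (potential true).tot G ≤ 5 * G.size ∧ G.roots.card = 0 := by
  have hblue : ∀ e ∈ G.edges, e.mark ≠ .blue := fun e he => by simp [hG.unmarked e he]
  have hpot : (potential true).tot G ≤ 5 * G.size := by
    have h1 : (G.edges.map fun e => (potential true).edge e.label e.mark).sum = 0 := by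
      refine Multiset.sum_eq_zero fun n hn => ?_
      obtain ⟨e, he, rfl⟩ := Multiset.mem_map.1 hn
      simp [hG.unmarked e he, potential]
    have h2 : ∑ v ∈ G.nodes, (potential true).node (G.attr v) = G.nodes.card * 5 :=
      Finset.sum_const_nat fun v hv => by simp [potential, hG.grey v hv]
    unfold TotalWeight.tot HostGraph.size
    omega
  refine ⟨⟨fun v hv => ?_, fun v hv => ?_, fun v hv => ?_, ?_, by omega⟩, hpot, ?_⟩
  · have h1 := hD v hv
    unfold Weight.loc
    rw [degree_eq_sum]
    have h2 : (degWeight true).node (G.attr v) = 4 := by simp [degWeight, hG.grey v hv]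
    omega
  · have h1 : (G.edges.map (blueInWeight.edge v)).sum = 0 := by
      refine Multiset.sum_eq_zero fun n hn => ?_
      obtain ⟨e, he, rfl⟩ := Multiset.mem_map.1 hn
      simp [Weight.edge, blueInWeight, hblue e he]
    rw [Weight.loc, h1]
    simp [blueInWeight, hG.grey v hv]
  · refine le_trans ?_ (Nat.le_add_right _ _)
    simp [blueOutWeight, hG.grey v hv]
  · unfold TotalWeight.tot
    simp only [labelledBlue, Finset.sum_const_zero, zero_add]
    refine Multiset.sum_eq_zero fun n hn => ?_
    obtain ⟨e, he, rfl⟩ := Multiset.mem_map.1 hn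
    simp [hblue e he]
  · rw [Finset.card_eq_zero, HostGraph.roots, Finset.filter_eq_empty_iff]
    intro v hv
    simp [hG.unrooted v hv]

/-- The left-hand side of `init` has no root, so all nodes are inspected, and each may be a match;
this linear cost arises once. -/
theorem callTime_init (G : HostGraph) : callTime [init] G ≤ 2 * G.size + 2 := by
  have hplan : init.L.plan = [.node (0 : Fin 1)] := rfl
  have h {n : ℕ} (P : Pattern n) (i : Fin n) (s : SearchState n) :
      searchTime P G [.node i] s ≤ 1 + G.nodes.card + G.nodes.card := by
    simp only [searchTime, Finset.sum_const, smul_eq_mul, mul_one]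
    exact Nat.add_le_add_left (Finset.card_filter_le _ _) _
  have h1 := h init.L (0 : Fin 1) ⟨fun _ => Option.none, 0⟩
  simp only [callTime, Rule.matchTime, hplan, List.map_cons, List.map_nil, List.sum_cons,
    List.sum_nil, HostGraph.size]
  omega

theorem greenRoot_of_applies_init {G H : HostGraph} (h : init.Applies G H) :
    1 ≤ greenRootCount.tot H := by
  obtain ⟨ι, g, h⟩ := h
  have h1 := h.tot greenRootCount
  have h2 : greenRootCount.pat init.L ι + 1 = greenRootCount.pat init.R ι := by
    unfold init
    simp [-Finset.sum_boole, Fin.sum_univ_succ, TotalWeight.pat, NodePat.inst, MarkPat.inst,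
      LabelPat.inst, nd, rt, arrow, x, nil, greenRootCount]
  omega

theorem spec_main {G : HostGraph} (hG : G.IsInput) (hD : ∀ v ∈ G.nodes, G.degree v ≤ D) :
    Spec Main G (300 * callBound (D + 4) * (G.size + 1)) (MainPost (6 * G.size)) := by
  have hK : 14 ≤ callBound (D + 4) := Nat.le_add_left _ _
  obtain ⟨h0, hφ, hroots⟩ := core_of_isInput hG hD
  set K := callBound (D + 4) with hKdef
  -- The summands pay for `init`, for the credit `50 * K` per unit of potential, for the reserves of
  -- both loops and the single calls, and for the `try`.
  have hB : 2 * G.size + 20 + (50 * K * (5 * G.size) + 30 * K) + 1 ≤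
      300 * K * (G.size + 1) := by
    nlinarith
  have hinit := callTime_init G
  have hrep : init.replaceTime = 4 := rfl
  refine (Spec.tryte (Spec.call (K := 2 * G.size + 20) ?_ (by omega) ?_ ?_)).mono_budget hB
  · intro r hr
    obtain rfl := List.mem_singleton.1 hr
    omega
  · intro r hr H h
    obtain rfl := List.mem_singleton.1 hr
    have h1 := card_roots_of_applies keeps_init h
    have h2 := potential_of_applies keeps_init h
    have hH : StackInv D (6 * G.size) H :=
      ⟨⟨h0.applies keeps_init h, greenRoot_of_applies_init h⟩, by omega⟩
    have h3 := Nat.mul_le_mul_left (50 * K) (show (potential true).tot H ≤ 5 * G.size by omega)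
    refine .seq (spec_stackNodes (c := 50 * K) (e := 20 * K) (by omega) (fun H' b hH' hb => ?_) hH
      (by omega))
    have h4 := Nat.mul_le_mul_left (50 * K) (potential_false_le H')
    -- A failure of `unroot` would only make the program fail, which `MainPost` permits.
    refine .seq ((Spec.call_one (B := 50 * K * (potential false).tot H' + 15 * K) isFast_unroot
      hH'.bounded (fun H'' h => ?_) fun _ => trivial).mono_budget (by omega))
    have h5 := card_roots_of_applies keeps_unroot h
    have h6 := hH'.2
    have h7 := Nat.mul_le_mul_left (50 * K) (potential_of_applies keeps_unroot h)
    rw [add_zero] at h7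
    refine .seq (spec_loopNodes (c := 50 * K) (e := 5 * K) (by omega) (fun H₃ b hH₃ hb => ?_)
      ⟨hH'.1.second.applies keeps_unroot h, .inl (by omega)⟩ (by omega))
    refine (Spec.if_call (B := 1) (by simpa using isFast_flag) (by simp) hH₃.bounded
      (.fail trivial) fun _ => .skip ?_).mono_budget (by omega)
    have := hH₃.1.size
    exact (Nat.le_add_right _ _).trans this
  · intro _
    refine (Spec.skip (B := 0) ?_).mono_budget (by omega)
    exact (by omega : G.size ≤ 6 * G.size)

end TopSort

end GP2

theorem mainTheorem2 (D : ℕ) :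
    ∃ c : ℕ, ∀ G : GP2.HostGraph, G.IsInput → (∀ v ∈ G.nodes, G.degree v ≤ D) →
      ¬ GP2.CanDiverge GP2.TopSort.Main G ∧
      ¬ GP2.CanGetStuck GP2.TopSort.Main G ∧
      ∀ t, GP2.TimeSpent GP2.TopSort.Main G t → t ≤ c * (G.size + 1) := by
  -- The summand 7 covers loading the input, once its size, and printing a result of at most six
  -- times that size.
  refine ⟨300 * GP2.callBound (D + 4) + 7, fun G hG hD => ?_⟩
  have h := GP2.TopSort.spec_main hG hD
  refine ⟨h.not_canDiverge, h.not_canGetStuck fun _ _ => id, fun t ht => ?_⟩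
  rw [add_mul]
  cases ht with
  | running hs =>
    have := h.time _ hs
    omega
  | printed hs =>
    obtain ⟨b, hb, hsize⟩ := h.post _ _ hs trivial
    have : _ ≤ 6 * G.size := hsize
    omega
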